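/- Let $G$ be a group. The Cayley graph of $G$ with respect to a generating set is regarded as a geodesic metric space in which every edge is isometric to $[0,1]$. $G$ is called hyperbolic if it has a finite generating set for which there is $\delta\ge 0$ such that all geodesic triangles in the Cayley graph are $\delta$-thin, that is, each side lies in the closed $\delta$-neighbourhood of the union of the other two sides. Let $\langle S\mid R\rangle$ be a finite presentation of $G$, let $F(S)$ be the free group on $S$, and for $w\in F(S)$ let $|w|_S$ be the length of the reduced word $w$. If $w=1$ in $G$, the area $A(w)$ is the least $n$ for which $w=\prod_{i=1}^n u_i r_i^{\pm1}u_i^{-1}$ in $F(S)$ with $u_i\in F(S)$ and $r_i\in R$. The presentation satisfies a linear isoperimetric inequality (has a linear Dehn function) if there is a constant $K$ with $A(w)\le K|w|_S$ for all $w\in F(S)$ with $w=1$ in $G$. A word contains more than half of a relator if it has a subword $r_1$ such that $r_1r_2$ is, as a reduced word, an element of $R$ for some word $r_2$ with $|r_2|<|r_1|$. The presentation is a Dehn presentation if every non-empty reduced word that represents $1$ in $G$ contains more than half of a relator. Then: 1. If $G$ is hyperbolic, then $G$ is finitely presented, and every finite presentation of $G$ satisfies a linear isoperimetric inequality. 2.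 If some finite presentation of $G$ satisfies a linear isoperimetric inequality, then $G$ is hyperbolic. 3. $G$ is hyperbolic if and only if it has a Dehn presentation. 4. Let $\langle S\mid R\rangle$ be a Dehn presentation of $G$. Then Dehn's algorithm solves the word problem. That is, starting from any word $w$ in $S\cup S^{-1}$, repeatedly either delete two adjacent mutually inverse letters, or replace a subword $r_1$ by $r_2^{-1}$, where $r_1r_2\in R$ and $|r_2|<|r_1|$. However the steps are chosen, there are at most as many steps as $w$ has letters, and when no further step is possible, the word reached is empty if and only if $w=1$ in $G$. 5. If $G$ has a Dehn presentation, then the word problem of $G$ is solvable: for every finite presentation $\langle S\mid R\rangle$ of $G$ there is an algorithm that decides which words in $S\cup S^{-1}$ represent $1$ in $G$. -/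

import Mathlib

namespace GGT

section Realization

/-! ## The metric space underlying a connected graph

Every edge of the graph is a copy of the unit interval, and the distance is the length of a
shortest path. -/

/-- A point of a connected graph `Γ`, described by a vertex (`src = tgt`) or an edge
(`src`, `tgt` adjacent) that carries it and by its distances `a`, `b` to `src` and `tgt` along it.
The same point may have several such descriptions; they are identified in `Realization`. -/
structure EdgePoint {V : Type*} {Γ : SimpleGraph V} (hΓ : Γ.Connected) where
  src : V
  tgt : V
  a : ℝ
  b : ℝ
  a_nonneg : 0 ≤ a
  b_nonneg : 0 ≤ b
  edge : (src = tgt ∧ a + b = 0) ∨ (Γ.Adj src tgt ∧ a + b = 1)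

namespace EdgePoint

variable {V : Type*} {Γ : SimpleGraph V} {hΓ : Γ.Connected}

/-- Length of a shortest path from `p` to `q` that passes through an endpoint of the edge of `p`
and an endpoint of the edge of `q`. -/
noncomputable def through (p q : EdgePoint hΓ) : ℝ :=
  min (min (p.a + Γ.dist p.src q.src + q.a) (p.a + Γ.dist p.src q.tgt + q.b))
    (min (p.b + Γ.dist p.tgt q.src + q.a) (p.b + Γ.dist p.tgt q.tgt + q.b))

open Classical in
/-- The path distance: inside a common edge (with the same or the opposite orientation) it is the
distance of the unit interval, otherwise a path has to pass through endpoints. -/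
noncomputable def pathDist (p q : EdgePoint hΓ) : ℝ :=
  if p.src = q.src ∧ p.tgt = q.tgt then |p.a - q.a|
  else if p.src = q.tgt ∧ p.tgt = q.src then |p.a - q.b|
  else through p q

theorem add_eq_dist (p : EdgePoint hΓ) : p.a + p.b = Γ.dist p.src p.tgt := by
  rcases p.edge with ⟨h, h'⟩ | ⟨h, h'⟩
  · rw [h', h, SimpleGraph.dist_self]; simp
  · rw [h', SimpleGraph.dist_eq_one_iff_adj.2 h]; simp

theorem pathDist_self (p : EdgePoint hΓ) : pathDist p p = 0 := by
  simp [pathDist]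

def IsEnd (p : EdgePoint hΓ) (x : V) (c : ℝ) : Prop :=
  (x = p.src ∧ c = p.a) ∨ (x = p.tgt ∧ c = p.b)

def SameEdge (p q : EdgePoint hΓ) : Prop :=
  (p.src = q.src ∧ p.tgt = q.tgt) ∨ (p.src = q.tgt ∧ p.tgt = q.src)

theorem IsEnd.nonneg {p : EdgePoint hΓ} {x : V} {c : ℝ} (h : IsEnd p x c) : 0 ≤ c := by
  rcases h with ⟨-, rfl⟩ | ⟨-, rfl⟩
  exacts [p.a_nonneg, p.b_nonneg]

theorem IsEnd.dist_le {p : EdgePoint hΓ} {x y : V} {c e : ℝ} (h : IsEnd p x c)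
    (h' : IsEnd p y e) : (Γ.dist x y : ℝ) ≤ c + e := by
  have h₁ := p.add_eq_dist
  have := p.a_nonneg
  have := p.b_nonneg
  rcases h with ⟨rfl, rfl⟩ | ⟨rfl, rfl⟩ <;> rcases h' with ⟨rfl, rfl⟩ | ⟨rfl, rfl⟩
  · simp; linarith
  · linarith
  · rw [Γ.dist_comm]; linarith
  · simp; linarith

theorem IsEnd.le_add {p : EdgePoint hΓ} {x y : V} {c e : ℝ} (h : IsEnd p x c)
    (h' : IsEnd p y e) : c ≤ Γ.dist x y + e := by
  have h₁ := p.add_eq_dist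
  have := p.a_nonneg
  have := p.b_nonneg
  rcases h with ⟨rfl, rfl⟩ | ⟨rfl, rfl⟩ <;> rcases h' with ⟨rfl, rfl⟩ | ⟨rfl, rfl⟩
  · simp
  · linarith
  · rw [Γ.dist_comm]; linarith
  · simp

theorem IsEnd.unique {p : EdgePoint hΓ} {x : V} {c e : ℝ} (h : IsEnd p x c)
    (h' : IsEnd p x e) : c = e := by
  have h₁ := h.le_add h'
  have h₂ := h'.le_add h
  simp only [SimpleGraph.dist_self, Nat.cast_zero, zero_add] at h₁ h₂
  exact le_antisymm h₁ h₂

theorem through_le {p q : EdgePoint hΓ} {x y : V} {c e : ℝ} (h : IsEnd p x c)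
    (h' : IsEnd q y e) : through p q ≤ c + Γ.dist x y + e := by
  unfold through
  rcases h with ⟨rfl, rfl⟩ | ⟨rfl, rfl⟩ <;> rcases h' with ⟨rfl, rfl⟩ | ⟨rfl, rfl⟩ <;> simp

theorem exists_through (p q : EdgePoint hΓ) :
    ∃ x y c e, IsEnd p x c ∧ IsEnd q y e ∧ through p q = c + Γ.dist x y + e := by
  have h1 : IsEnd p p.src p.a := Or.inl ⟨rfl, rfl⟩
  have h2 : IsEnd p p.tgt p.b := Or.inr ⟨rfl, rfl⟩
  have h3 : IsEnd q q.src q.a := Or.inl ⟨rfl, rfl⟩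
  have h4 : IsEnd q q.tgt q.b := Or.inr ⟨rfl, rfl⟩
  unfold through
  rcases min_choice (min (p.a + Γ.dist p.src q.src + q.a) (p.a + Γ.dist p.src q.tgt + q.b))
    (min (p.b + Γ.dist p.tgt q.src + q.a) (p.b + Γ.dist p.tgt q.tgt + q.b)) with h | h <;> rw [h]
  · rcases min_choice (p.a + Γ.dist p.src q.src + q.a) (p.a + Γ.dist p.src q.tgt + q.b)
      with h | h <;> rw [h]
    exacts [⟨_, _, _, _, h1, h3, rfl⟩, ⟨_, _, _, _, h1, h4, rfl⟩]
  · rcases min_choice (p.b + Γ.dist p.tgt q.src + q.a) (p.b + Γ.dist p.tgt q.tgt + q.b)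
      with h | h <;> rw [h]
    exacts [⟨_, _, _, _, h2, h3, rfl⟩, ⟨_, _, _, _, h2, h4, rfl⟩]

theorem through_comm (p q : EdgePoint hΓ) : through p q = through q p := by
  have key : ∀ p q : EdgePoint hΓ, through p q ≤ through q p := fun p q => by
    obtain ⟨x, y, c, e, hx, hy, h⟩ := exists_through q p
    have := through_le hy hx
    rw [Γ.dist_comm] at this
    linarith
  exact le_antisymm (key p q) (key q p)

theorem through_triangle (p q r : EdgePoint hΓ) :
    through p r ≤ through p q + through q r := by
  obtain ⟨x, y, c, e, hx, hy, h⟩ := exists_through p q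
  obtain ⟨y', z, e', d, hy', hz, h'⟩ := exists_through q r
  have h₁ := through_le hx hz
  have h₂ := hy.dist_le hy'
  have h₃ : (Γ.dist x z : ℝ) ≤ Γ.dist x y + Γ.dist y z := by exact_mod_cast hΓ.dist_triangle
  have h₄ : (Γ.dist y z : ℝ) ≤ Γ.dist y y' + Γ.dist y' z := by exact_mod_cast hΓ.dist_triangle
  linarith

theorem SameEdge.symm {p q : EdgePoint hΓ} (h : SameEdge p q) : SameEdge q p := by
  rcases h with ⟨h, h'⟩ | ⟨h, h'⟩
  exacts [Or.inl ⟨h.symm, h'.symm⟩, Or.inr ⟨h'.symm, h.symm⟩]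

theorem SameEdge.trans {p q r : EdgePoint hΓ} (h : SameEdge p q) (h' : SameEdge q r) :
    SameEdge p r := by
  unfold SameEdge at *
  rcases h with ⟨h₁, h₂⟩ | ⟨h₁, h₂⟩ <;> rcases h' with ⟨h₃, h₄⟩ | ⟨h₃, h₄⟩ <;> simp_all

theorem pathDist_of_not {p q : EdgePoint hΓ} (h : ¬ SameEdge p q) :
    pathDist p q = through p q := by
  unfold pathDist
  rw [if_neg fun h' => h (Or.inl h'), if_neg fun h' => h (Or.inr h')]

theorem SameEdge.exists_end {p q : EdgePoint hΓ} (h : SameEdge p q) {x : V} {c : ℝ}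
    (hx : IsEnd p x c) : ∃ e, IsEnd q x e ∧ pathDist p q = |c - e| := by
  have h₁ := p.add_eq_dist
  have h₂ := q.add_eq_dist
  unfold pathDist
  by_cases h' : p.src = q.src ∧ p.tgt = q.tgt
  · rw [if_pos h']
    rw [h'.1, h'.2, ← h₂] at h₁
    rcases hx with ⟨rfl, rfl⟩ | ⟨rfl, rfl⟩
    · exact ⟨q.a, Or.inl ⟨h'.1, rfl⟩, rfl⟩
    · refine ⟨q.b, Or.inr ⟨h'.2, rfl⟩, ?_⟩
      rw [abs_sub_comm]
      congr 1
      linarith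
  · have h'' := h.resolve_left h'
    rw [if_neg h', if_pos h'']
    rw [h''.1, h''.2, Γ.dist_comm, ← h₂] at h₁
    rcases hx with ⟨rfl, rfl⟩ | ⟨rfl, rfl⟩
    · exact ⟨q.b, Or.inr ⟨h''.1, rfl⟩, rfl⟩
    · refine ⟨q.a, Or.inl ⟨h''.2, rfl⟩, ?_⟩
      rw [abs_sub_comm]
      congr 1
      linarith

theorem pathDist_comm (p q : EdgePoint hΓ) : pathDist p q = pathDist q p := by
  by_cases h : SameEdge p q
  · obtain ⟨e, he, h₁⟩ := h.exists_end (x := p.src) (c := p.a) (Or.inl ⟨rfl, rfl⟩)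
    obtain ⟨e', he', h₂⟩ := h.symm.exists_end he
    rw [h₁, h₂, he'.unique (Or.inl ⟨rfl, rfl⟩), abs_sub_comm]
  · rw [pathDist_of_not h, pathDist_of_not fun h' => h h'.symm, through_comm]

theorem pathDist_le_through (p q : EdgePoint hΓ) : pathDist p q ≤ through p q := by
  by_cases h : SameEdge p q
  · obtain ⟨x, y, c, e, hx, hy, h₁⟩ := exists_through p q
    obtain ⟨c', hc', h₂⟩ := h.exists_end hx
    rw [h₁, h₂, abs_le]
    have h₃ := hc'.le_add hy
    have h₄ := hx.nonneg
    have h₅ := hc'.nonneg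
    have h₆ := hy.nonneg
    have h₇ : (0 : ℝ) ≤ Γ.dist x y := Nat.cast_nonneg _
    constructor <;> linarith
  · exact (pathDist_of_not h).le

theorem through_le_pathDist_add (p q r : EdgePoint hΓ) :
    through p r ≤ pathDist p q + through q r := by
  by_cases h : SameEdge p q
  · obtain ⟨x, y, c, e, hx, hy, h₁⟩ := exists_through q r
    obtain ⟨c', hc', h₂⟩ := h.symm.exists_end hx
    rw [pathDist_comm, h₁, h₂]
    have h₃ := through_le hc' hy
    have h₄ := neg_abs_le (c - c')
    linarith
  · rw [pathDist_of_not h]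
    exact through_triangle p q r

theorem pathDist_triangle (p q r : EdgePoint hΓ) :
    pathDist p r ≤ pathDist p q + pathDist q r := by
  by_cases h : SameEdge p q
  · by_cases h' : SameEdge q r
    · obtain ⟨e, he, h₁⟩ := h.exists_end (x := p.src) (c := p.a) (Or.inl ⟨rfl, rfl⟩)
      obtain ⟨d, hd, h₂⟩ := h'.exists_end he
      obtain ⟨d', hd', h₃⟩ := (h.trans h').exists_end (x := p.src) (c := p.a) (Or.inl ⟨rfl, rfl⟩)
      rw [h₁, h₂, h₃, hd'.unique hd]
      exact abs_sub_le _ _ _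
    · rw [pathDist_of_not h']
      exact (pathDist_le_through p r).trans (through_le_pathDist_add p q r)
  · have h₁ := through_le_pathDist_add r q p
    rw [pathDist_of_not h, through_comm p q, pathDist_comm q r]
    have h₂ := pathDist_le_through p r
    rw [through_comm p r] at h₂
    linarith

noncomputable instance : PseudoMetricSpace (EdgePoint hΓ) where
  dist := pathDist
  dist_self := pathDist_self
  dist_comm := pathDist_comm
  dist_triangle := pathDist_triangle

end EdgePoint

/-- The connected graph `Γ` as a metric space whose edges are isometric to `[0, 1]`: descriptions
at distance zero denote the same point. -/
abbrev Realization {V : Type*} {Γ : SimpleGraph V} (hΓ : Γ.Connected) : Type _ :=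
  SeparationQuotient (EdgePoint hΓ)

end Realization

section Rips

/-- `σ` is (the image of) a geodesic segment from `x` to `y`. -/
def IsGeodesicSegment {X : Type*} [MetricSpace X] (x y : X) (σ : Set X) : Prop :=
  ∃ f : ℝ → X, f 0 = x ∧ f (dist x y) = y ∧
    (∀ s ∈ Set.Icc 0 (dist x y), ∀ t ∈ Set.Icc 0 (dist x y), dist (f s) (f t) = |s - t|) ∧
    σ = f '' Set.Icc 0 (dist x y)

/-- All geodesic triangles of `X` are `δ`-thin: each side lies in the closed `δ`-neighbourhood of
the union of the two other sides. -/
def ThinTriangles (X : Type*) [MetricSpace X] (δ : ℝ) : Prop :=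
  ∀ (x y z : X) (σ₁ σ₂ σ₃ : Set X), IsGeodesicSegment x y σ₁ → IsGeodesicSegment x z σ₂ →
    IsGeodesicSegment y z σ₃ → ∀ p ∈ σ₁, ∃ q ∈ σ₂ ∪ σ₃, dist p q ≤ δ

/-- Hyperbolicity in the sense of Rips. -/
def IsRipsHyperbolic (X : Type*) [MetricSpace X] : Prop :=
  ∃ δ : ℝ, 0 ≤ δ ∧ ThinTriangles X δ

end Rips

section Cayley

variable {G : Type*} [Group G]

theorem mulCayley_connected (S : Set G) (hS : Subgroup.closure S = ⊤) :
    (SimpleGraph.mulCayley S).Connected := by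
  have key : ∀ g : G, g ∈ Subgroup.closure S → ∀ x : G,
      (SimpleGraph.mulCayley S).Reachable x (x * g) := by
    intro g hg
    induction hg using Subgroup.closure_induction with
    | mem s hs =>
      intro x
      by_cases h : x = x * s
      · rw [← h]
      · exact SimpleGraph.Adj.reachable
          ((SimpleGraph.mulCayley_adj' S x (x * s)).2 ⟨h, s, hs, Or.inl rfl⟩)
    | one => intro x; rw [mul_one]
    | mul g h _ _ ihg ihh => intro x; rw [← mul_assoc]; exact (ihg x).trans (ihh (x * g))
    | inv g _ ih =>
      intro x
      have h := ih (x * g⁻¹)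
      rw [inv_mul_cancel_right] at h
      exact h.symm
  refine (SimpleGraph.connected_iff _).2 ⟨fun x y => ?_, ⟨1⟩⟩
  have h := key (x⁻¹ * y) (hS ▸ Subgroup.mem_top _) x
  rwa [mul_inv_cancel_left] at h

/-- The Cayley graph of `G` with respect to the generating set `S`, as a metric space. -/
abbrev CayleySpace (S : Set G) (hS : Subgroup.closure S = ⊤) : Type _ :=
  Realization (mulCayley_connected S hS)

/-- A group is hyperbolic if it has a finite generating set whose Cayley graph is hyperbolic. -/
def IsHyperbolicGroup (G : Type*) [Group G] : Prop :=
  ∃ (S : Set G) (hS : Subgroup.closure S = ⊤), S.Finite ∧ IsRipsHyperbolic (CayleySpace S hS)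

end Cayley

section Presentations

/-- A finite presentation `⟨S ∣ R⟩` of `G`, with `S` indexed by `Fin n`: `proj` is the epimorphism
from the free group on the generators to `G`. -/
structure FinitePresentation (G : Type*) [Group G] where
  n : ℕ
  proj : FreeGroup (Fin n) →* G
  rels : Set (FreeGroup (Fin n))
  rels_finite : rels.Finite
  proj_surjective : Function.Surjective proj
  normalClosure_rels : Subgroup.normalClosure rels = proj.ker

namespace FinitePresentation

variable {G : Type*} [Group G] (P : FinitePresentation G)

/-- The words in the generators and their inverses; `(i, true)` is the `i`-th generator and
`(i, false)` its inverse. -/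
abbrev Word : Type := List (Fin P.n × Bool)

/-- The word `w` represents the identity of `G`. -/
def Trivial (w : P.Word) : Prop := P.proj (FreeGroup.mk w) = 1

/-- The element `x` has the form `u r u⁻¹` or `u r⁻¹ u⁻¹` for a relator `r`. -/
def IsRelatorConj (x : FreeGroup (Fin P.n)) : Prop :=
  ∃ u, ∃ r ∈ P.rels, x = u * r * u⁻¹ ∨ x = u * r⁻¹ * u⁻¹

/-- The combinatorial area of `w`, the least number of factors in an expression of `w` as a product
of conjugates of relators and their inverses. It is used only for `w` with `P.proj w = 1`, and
such an expression exists then. -/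
noncomputable def area (w : FreeGroup (Fin P.n)) : ℕ :=
  sInf {k | ∃ l : List (FreeGroup (Fin P.n)),
    l.length = k ∧ (∀ x ∈ l, P.IsRelatorConj x) ∧ l.prod = w}

/-- `f` is a Dehn function (isoperimetric function) for the presentation. -/
def IsDehnFunction (f : ℕ → ℕ) : Prop :=
  ∀ w : FreeGroup (Fin P.n), P.proj w = 1 → P.area w ≤ f w.norm

/-- The presentation satisfies a linear isoperimetric inequality. -/
def HasLinearDehnFunction : Prop := ∃ K : ℕ, P.IsDehnFunction fun m => K * m

/-- `w` is `x r₁ y` and `w'` is `x r₂⁻¹ y`, where the word `r₁ r₂` is a relator and `r₁` is more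
than half of it. -/
def Shortens (w w' : P.Word) : Prop :=
  ∃ x y r₁ r₂ : P.Word, (∃ r ∈ P.rels, r.toWord = r₁ ++ r₂) ∧ r₂.length < r₁.length ∧
    w = x ++ r₁ ++ y ∧ w' = x ++ FreeGroup.invRev r₂ ++ y

/-- `w` contains more than half of a relator. -/
def ContainsMostOfRelator (w : P.Word) : Prop :=
  ∃ x y r₁ r₂ : P.Word, (∃ r ∈ P.rels, r.toWord = r₁ ++ r₂) ∧ r₂.length < r₁.length ∧
    w = x ++ r₁ ++ y

/-- A Dehn presentation: every nontrivial reduced word that represents the identity of `G` contains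
more than half of a relator. -/
def IsDehn : Prop :=
  ∀ w : FreeGroup (Fin P.n), w ≠ 1 → P.proj w = 1 → P.ContainsMostOfRelator w.toWord

/-- One step of Dehn's algorithm: cancel two adjacent mutually inverse letters, or replace more
than half of a relator by the shorter word that represents the same element of `G`. -/
def DehnStep (w w' : P.Word) : Prop := FreeGroup.Red.Step w w' ∨ P.Shortens w w'

/-- Dehn's algorithm solves the word problem: however the steps are chosen, a run that starts from
`w` has at most as many steps as `w` has letters, and when no step is possible any more, the word
reached is empty if and only if `w` represents the identity. -/
def DehnAlgorithmCorrect : Prop :=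
  ∀ w : P.Word,
    (∀ (k : ℕ) (s : ℕ → P.Word), s 0 = w → (∀ i < k, P.DehnStep (s i) (s (i + 1))) →
      k ≤ w.length) ∧
    ∀ w', Relation.ReflTransGen P.DehnStep w w' → (∀ w'', ¬ P.DehnStep w' w'') →
      (w' = [] ↔ P.Trivial w)

/-- The word problem is solvable: some algorithm decides which words represent the identity. -/
def WordProblemSolvable : Prop := ComputablePred P.Trivial

end FinitePresentation

end Presentations

end GGT

/-! Hyperbolicity yields a Dehn presentation, a Dehn presentation yields a linear Dehn function, and
a linear Dehn function yields hyperbolicity.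

In a graph with `δ`-thin triangles a nontrivial closed path cannot be geodesic on all stretches of
length `2 D` with `D > 2 δ`: at a point farthest from the base point, thinness applied to the
geodesic between the points `D` before and `D` after it forces one of these to be farther still
(`eq_zero_of_local_geodesic_loop`). Hence a nonempty word for `1` contains a short non-geodesic
subword. The shortest such subword, closed up by a geodesic, is a reduced kernel element of length
at most `4 D`, more than half of which lies in the word (`exists_mostOfRelator`). The finitely many
kernel elements of that length form a Dehn presentation.

Each replacement in Dehn's algorithm uses one conjugate of a relator and shortens the word, so the
area is at most the length (`areaLE_norm_of_dehn`), and linearity passes to every finite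
presentation (`HasLinearDehnFunction.transfer`). The same shortening makes the algorithm terminate,
and run with a fixed schedule it is primitive recursive.

The converse is a discrete Stokes argument. For 1-Lipschitz `f` and `g`, integrate `f dg` along edge
paths by the trapezoid rule. Free cancellation does not change the integral, and conjugation only
moves the base point. Around a relator the integral is bounded, so around a closed path of length
`n` it is `O(n)` when the Dehn function is linear (`ChainInequality`). Suppose a point `p` of one
side of a triangle is about `D` away from the other two sides. Let `f` be a cone about `p` of height
about `D / 2` and `g` the distance from an end of the side. The integral along the side is of order
`D ^ 2`, while a return path of length `O(D)` avoids the support of `f`. So `D` is bounded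
(`ChainInequality.fat_le`). The return path exists because `D` is chosen minimal with every side
`D`-close to the union of the other two. -/

namespace GGT

/-! ### Area in free groups and its behaviour under homomorphisms -/

section RelatorProducts

variable {α β : Type*}

/-- `w` is a product of at most `k` conjugates of elements of `R` and their inverses. -/
def AreaLE (R : Set (FreeGroup α)) (k : ℕ) (w : FreeGroup α) : Prop :=
  ∃ l : List (FreeGroup α), l.length ≤ k ∧
    (∀ x ∈ l, ∃ u, ∃ r ∈ R, x = u * r * u⁻¹ ∨ x = u * r⁻¹ * u⁻¹) ∧ l.prod = w

namespace AreaLE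

variable {R : Set (FreeGroup α)} {k m : ℕ} {v w : FreeGroup α}

theorem one : AreaLE R k 1 := ⟨[], by simp⟩

theorem mono (h : AreaLE R k w) (hkm : k ≤ m) : AreaLE R m w := by
  obtain ⟨l, h₁, h₂, h₃⟩ := h
  exact ⟨l, h₁.trans hkm, h₂, h₃⟩

theorem mul (h : AreaLE R k v) (h' : AreaLE R m w) : AreaLE R (k + m) (v * w) := by
  obtain ⟨l, h₁, h₂, rfl⟩ := h
  obtain ⟨l', h₁', h₂', rfl⟩ := h'
  refine ⟨l ++ l', by simp; omega, fun x hx => ?_, by simp⟩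
  rcases List.mem_append.1 hx with hx | hx
  exacts [h₂ x hx, h₂' x hx]

theorem of_mem {r : FreeGroup α} (hr : r ∈ R) : AreaLE R 1 r :=
  ⟨[r], by simp, by simpa using ⟨1, r, hr, by simp⟩, by simp⟩

theorem conj (h : AreaLE R k w) (g : FreeGroup α) : AreaLE R k (g * w * g⁻¹) := by
  obtain ⟨l, h₁, h₂, rfl⟩ := h
  refine ⟨l.map (MulAut.conj g), by simpa using h₁, fun x hx => ?_, ?_⟩
  · obtain ⟨y, hy, rfl⟩ := List.mem_map.1 hx
    obtain ⟨u, r, hr, rfl | rfl⟩ := h₂ y hy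
    · exact ⟨g * u, r, hr, Or.inl (by simp [mul_assoc])⟩
    · exact ⟨g * u, r, hr, Or.inr (by simp [mul_assoc])⟩
  · rw [← map_list_prod]
    simp

theorem inv (h : AreaLE R k w) : AreaLE R k w⁻¹ := by
  obtain ⟨l, h₁, h₂, rfl⟩ := h
  refine ⟨(l.map (·⁻¹)).reverse, by simpa using h₁, fun x hx => ?_, ?_⟩
  · obtain ⟨y, hy, rfl⟩ := List.mem_map.1 (List.mem_reverse.1 hx)
    obtain ⟨u, r, hr, rfl | rfl⟩ := h₂ y hy
    · exact ⟨u, r, hr, Or.inr (by simp [mul_assoc])⟩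
    · exact ⟨u, r, hr, Or.inl (by simp [mul_assoc])⟩
  · rw [List.prod_inv_reverse]

theorem mem_normalClosure (h : AreaLE R k w) : w ∈ Subgroup.normalClosure R := by
  obtain ⟨l, -, h₂, rfl⟩ := h
  refine Subgroup.list_prod_mem _ fun x hx => ?_
  obtain ⟨u, r, hr, rfl | rfl⟩ := h₂ x hx
  · exact Subgroup.normalClosure_normal.conj_mem _ (Subgroup.subset_normalClosure hr) _
  · exact Subgroup.normalClosure_normal.conj_mem _
      (Subgroup.inv_mem _ (Subgroup.subset_normalClosure hr)) _

theorem exists_of_mem (h : w ∈ Subgroup.normalClosure R) : ∃ k, AreaLE R k w := by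
  have hle : Subgroup.normalClosure R ≤
      { carrier := {w | ∃ k, AreaLE R k w}
        one_mem' := ⟨0, one⟩
        mul_mem' := fun ⟨k, hk⟩ ⟨m, hm⟩ => ⟨k + m, hk.mul hm⟩
        inv_mem' := fun ⟨k, hk⟩ => ⟨k, hk.inv⟩ : Subgroup (FreeGroup α) } := by
    have : Subgroup.Normal
      { carrier := {w | ∃ k, AreaLE R k w}
        one_mem' := ⟨0, one⟩
        mul_mem' := fun ⟨k, hk⟩ ⟨m, hm⟩ => ⟨k + m, hk.mul hm⟩
        inv_mem' := fun ⟨k, hk⟩ => ⟨k, hk.inv⟩ : Subgroup (FreeGroup α) } :=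
      ⟨fun _ ⟨k, hk⟩ g => ⟨k, hk.conj g⟩⟩
    exact Subgroup.normalClosure_le_normal fun r hr => ⟨1, of_mem hr⟩
  exact hle h

/-- Every conjugate of a relator has area at most `m` with respect to the new relators. -/
theorem map {R' : Set (FreeGroup β)} (φ : FreeGroup α →* FreeGroup β)
    (hφ : ∀ r ∈ R, AreaLE R' m (φ r)) (h : AreaLE R k w) : AreaLE R' (k * m) (φ w) := by
  obtain ⟨l, h₁, h₂, rfl⟩ := h
  refine mono (k := l.length * m) ?_ (Nat.mul_le_mul_right m h₁)
  clear h₁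
  induction l with
  | nil => simpa using one
  | cons x l ih =>
    rw [List.prod_cons, map_mul, List.length_cons, add_mul, one_mul, add_comm]
    refine mul ?_ (ih fun y hy => h₂ y (List.mem_cons_of_mem _ hy))
    obtain ⟨u, r, hr, rfl | rfl⟩ := h₂ x List.mem_cons_self
    · simpa using (hφ r hr).conj (φ u)
    · simpa using (hφ r hr).inv.conj (φ u)

end AreaLE

/-- Gives a uniform constant when finitely many relators or generators are rewritten in another
presentation. -/
theorem exists_forall_areaLE {R' : Set (FreeGroup β)} {T : Set (FreeGroup β)} (hT : T.Finite)
    (h : ∀ t ∈ T, t ∈ Subgroup.normalClosure R') : ∃ m, ∀ t ∈ T, AreaLE R' m t := by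
  induction T, hT using Set.Finite.induction_on with
  | empty => exact ⟨0, by simp⟩
  | @insert a T _ _ ih =>
    obtain ⟨m, hm⟩ := ih fun t ht => h t (Set.mem_insert_of_mem _ ht)
    obtain ⟨k, hk⟩ := AreaLE.exists_of_mem (h a (Set.mem_insert _ _))
    refine ⟨max k m, fun t ht => ?_⟩
    rcases ht with rfl | ht
    exacts [hk.mono (le_max_left _ _), (hm t ht).mono (le_max_right _ _)]

theorem norm_map_le [DecidableEq α] [DecidableEq β] (φ : FreeGroup α →* FreeGroup β) {L : ℕ}
    (hφ : ∀ a, (φ (FreeGroup.of a)).norm ≤ L) (w : FreeGroup α) :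
    (φ w).norm ≤ L * w.norm := by
  have key : ∀ l : List (α × Bool), (φ (FreeGroup.mk l)).norm ≤ L * l.length := by
    intro l
    induction l with
    | nil => simp [← FreeGroup.one_eq_mk]
    | cons x l ih =>
      rw [show FreeGroup.mk (x :: l) = FreeGroup.mk [x] * FreeGroup.mk l by
        rw [FreeGroup.mul_mk]; rfl, map_mul]
      refine (FreeGroup.norm_mul_le _ _).trans ?_
      rw [List.length_cons, mul_add, mul_one, add_comm]
      refine add_le_add ih ?_
      obtain ⟨a, _ | _⟩ := x
      · have : FreeGroup.mk [(a, false)] = (FreeGroup.of a)⁻¹ := by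
          simp [FreeGroup.of, FreeGroup.inv_mk, FreeGroup.invRev]
        rw [this, map_inv, FreeGroup.norm_inv_eq]
        exact hφ a
      · exact hφ a
  have := key w.toWord
  rwa [FreeGroup.mk_toWord] at this

/-- A homomorphism that moves each generator by an element of area at most `m` moves `w` by an
element of area at most `m |w|`. -/
theorem areaLE_map_mul_inv [DecidableEq α] {R : Set (FreeGroup α)} (φ : FreeGroup α →* FreeGroup α)
    {m : ℕ} (hφ : ∀ a, AreaLE R m (φ (FreeGroup.of a) * (FreeGroup.of a)⁻¹)) (w : FreeGroup α) :
    AreaLE R (m * w.norm) (φ w * w⁻¹) := by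
  have key : ∀ l : List (α × Bool),
      AreaLE R (m * l.length) (φ (FreeGroup.mk l) * (FreeGroup.mk l)⁻¹) := by
    intro l
    induction l with
    | nil => simpa [← FreeGroup.one_eq_mk] using AreaLE.one
    | cons x l ih =>
      have hcons : FreeGroup.mk (x :: l) = FreeGroup.mk [x] * FreeGroup.mk l := by
        rw [FreeGroup.mul_mk]; rfl
      have hx : AreaLE R m (φ (FreeGroup.mk [x]) * (FreeGroup.mk [x])⁻¹) := by
        obtain ⟨a, _ | _⟩ := x
        · have : FreeGroup.mk [(a, false)] = (FreeGroup.of a)⁻¹ := by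
            simp [FreeGroup.of, FreeGroup.inv_mk, FreeGroup.invRev]
          rw [this, map_inv]
          simpa [mul_assoc] using (hφ a).inv.conj (φ (FreeGroup.of a))⁻¹
        · exact hφ a
      have := (ih.conj (φ (FreeGroup.mk [x]))).mul hx
      simpa [hcons, mul_add, mul_assoc, -FreeGroup.inv_mk, -FreeGroup.mul_mk] using this
  have := key w.toWord
  rwa [FreeGroup.mk_toWord] at this

/-- If every nontrivial element of the kernel contains more than half of a relator, then an
element of the kernel is a product of at most as many conjugates of relators as it has letters. -/
theorem areaLE_norm_of_dehn [DecidableEq α] {G : Type*} [Group G] (π : FreeGroup α →* G)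
    {R : Set (FreeGroup α)} (hR : ∀ r ∈ R, π r = 1)
    (hD : ∀ w, w ≠ 1 → π w = 1 → ∃ x y r₁ r₂, (∃ r ∈ R, r.toWord = r₁ ++ r₂) ∧
      r₂.length < r₁.length ∧ w.toWord = x ++ r₁ ++ y) (w : FreeGroup α) (hw : π w = 1) :
    AreaLE R w.norm w := by
  induction hn : w.norm using Nat.strong_induction_on generalizing w with
  | _ n ih =>
    by_cases h1 : w = 1
    · rw [h1]; exact AreaLE.one
    · obtain ⟨x, y, r₁, r₂, ⟨r, hr, hr'⟩, hlt, hw'⟩ := hD w h1 hw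
      have hrm : r = FreeGroup.mk r₁ * FreeGroup.mk r₂ := by
        rw [FreeGroup.mul_mk, ← hr', FreeGroup.mk_toWord]
      have hwm : w = FreeGroup.mk x * FreeGroup.mk r₁ * FreeGroup.mk y := by
        rw [FreeGroup.mul_mk, FreeGroup.mul_mk, ← hw', FreeGroup.mk_toWord]
      -- One replacement: `w` is a conjugate of `r` times the shorter element `v`, so a shorter
      -- length pays for one relator.
      set v : FreeGroup α := FreeGroup.mk (x ++ FreeGroup.invRev r₂ ++ y) with hv
      have hvm : v = FreeGroup.mk x * (FreeGroup.mk r₂)⁻¹ * FreeGroup.mk y := by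
        rw [hv, FreeGroup.inv_mk, FreeGroup.mul_mk, FreeGroup.mul_mk]
      have hwv : w = (FreeGroup.mk x * r * (FreeGroup.mk x)⁻¹) * v := by
        rw [hvm, hrm, hwm]; group
      have hvn : v.norm < n := by
        have h₁ : v.norm ≤ _ := FreeGroup.norm_mk_le
        have h₂ : w.norm = _ := congrArg List.length hw'
        simp only [List.length_append, FreeGroup.invRev_length] at h₁ h₂
        omega
      have hπv : π v = 1 := by
        rw [hwv, map_mul, map_mul, map_mul, hR r hr] at hw
        simpa [-FreeGroup.inv_mk] using hw
      rw [hwv]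
      exact (((AreaLE.of_mem hr).conj _).mul (ih _ hvn v hπv rfl)).mono (by omega)

end RelatorProducts

namespace FinitePresentation

variable {G : Type*} [Group G] (P : FinitePresentation G)

theorem proj_rel {r : FreeGroup (Fin P.n)} (hr : r ∈ P.rels) : P.proj r = 1 := by
  have : r ∈ P.proj.ker := P.normalClosure_rels ▸ Subgroup.subset_normalClosure hr
  exact this

theorem exists_areaLE {w : FreeGroup (Fin P.n)} (hw : P.proj w = 1) :
    ∃ k, AreaLE P.rels k w :=
  AreaLE.exists_of_mem (by rw [P.normalClosure_rels]; exact hw)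

theorem area_le {w : FreeGroup (Fin P.n)} {k : ℕ} (h : AreaLE P.rels k w) : P.area w ≤ k := by
  obtain ⟨l, h₁, h₂, h₃⟩ := h
  have : P.area w ≤ l.length := Nat.sInf_le ⟨l, rfl, h₂, h₃⟩
  exact this.trans h₁

/-- The infimum defining the area is attained, because an element of the kernel has at least one
expression by relators. -/
theorem areaLE_area {w : FreeGroup (Fin P.n)} (hw : P.proj w = 1) :
    AreaLE P.rels (P.area w) w := by
  obtain ⟨k, l, h₁, h₂, h₃⟩ := P.exists_areaLE hw
  have hne : {k | ∃ l : List (FreeGroup (Fin P.n)),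
      l.length = k ∧ (∀ x ∈ l, P.IsRelatorConj x) ∧ l.prod = w}.Nonempty := ⟨_, l, rfl, h₂, h₃⟩
  obtain ⟨l', h₁', h₂', h₃'⟩ :
      P.area w ∈ {k | ∃ l : List (FreeGroup (Fin P.n)),
        l.length = k ∧ (∀ x ∈ l, P.IsRelatorConj x) ∧ l.prod = w} := Nat.sInf_mem hne
  exact ⟨l', h₁'.le, h₂', h₃'⟩

variable {P} in
theorem HasLinearDehnFunction.areaLE (h : P.HasLinearDehnFunction) :
    ∃ K : ℕ, ∀ w, P.proj w = 1 → AreaLE P.rels (K * w.norm) w := by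
  obtain ⟨K, hK⟩ := h
  exact ⟨K, fun w hw => (P.areaLE_area hw).mono (hK w hw)⟩

variable {P} in
theorem IsDehn.hasLinearDehnFunction (h : P.IsDehn) : P.HasLinearDehnFunction :=
  ⟨1, fun w hw => by
    simp only [one_mul]
    exact P.area_le (areaLE_norm_of_dehn P.proj (fun _ => P.proj_rel) h w hw)⟩

/-- A homomorphism between the free groups of two presentations that lifts the identity. -/
theorem exists_lift (P Q : FinitePresentation G) :
    ∃ φ : FreeGroup (Fin P.n) →* FreeGroup (Fin Q.n), ∀ w, Q.proj (φ w) = P.proj w := by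
  choose f hf using fun i => Q.proj_surjective (P.proj (FreeGroup.of i))
  refine ⟨FreeGroup.lift f, fun w => ?_⟩
  have : Q.proj.comp (FreeGroup.lift f) = P.proj := by
    ext i
    simp [hf]
  exact DFunLike.congr_fun this w

/-- Linearity of the Dehn function does not depend on the finite presentation. -/
theorem HasLinearDehnFunction.transfer {P : FinitePresentation G} (h : P.HasLinearDehnFunction)
    (Q : FinitePresentation G) : Q.HasLinearDehnFunction := by
  obtain ⟨K, hK⟩ := h.areaLE
  obtain ⟨φ, hφ⟩ := exists_lift Q P
  obtain ⟨ψ, hψ⟩ := exists_lift P Q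
  obtain ⟨m, hm⟩ := exists_forall_areaLE (R' := Q.rels) (P.rels_finite.image ψ) (by
    rintro _ ⟨r, hr, rfl⟩
    rw [Q.normalClosure_rels]
    exact (hψ r).trans (P.proj_rel hr))
  obtain ⟨e, he⟩ := exists_forall_areaLE (R' := Q.rels)
    (T := Set.range fun i => ψ (φ (FreeGroup.of i)) * (FreeGroup.of i)⁻¹) (Set.finite_range _) (by
    rintro _ ⟨i, rfl⟩
    rw [Q.normalClosure_rels, MonoidHom.mem_ker, map_mul, hψ, hφ, map_inv, mul_inv_cancel])
  obtain ⟨L, hL⟩ : ∃ L, ∀ i, (φ (FreeGroup.of i)).norm ≤ L :=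
    ⟨Finset.univ.sup fun i => (φ (FreeGroup.of i)).norm, fun i =>
      Finset.le_sup (f := fun i => (φ (FreeGroup.of i)).norm) (Finset.mem_univ i)⟩
  refine ⟨e + K * L * m, fun w hw => Q.area_le ?_⟩
  -- Factor `w` as `(ψ(φ w) w⁻¹)⁻¹ * ψ(φ w)`. The first factor costs `e` per letter of `w`; the
  -- second is the image of a filling of `φ w`, each relator of which costs `m`.
  have h₁ := areaLE_map_mul_inv (R := Q.rels) (ψ.comp φ) (fun a => he _ ⟨a, rfl⟩) w
  have h₂ := (hK (φ w) ((hφ w).trans hw)).map ψ fun r hr => hm _ ⟨r, hr, rfl⟩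
  have h₃ := h₁.inv.mul h₂
  have h₄ : (ψ.comp φ w * w⁻¹)⁻¹ * ψ (φ w) = w := by simp
  rw [h₄] at h₃
  refine h₃.mono ?_
  have := norm_map_le φ hL w
  calc e * w.norm + K * (φ w).norm * m ≤ e * w.norm + K * (L * w.norm) * m := by gcongr
    _ = (e + K * L * m) * w.norm := by ring

theorem isFinitelyPresented (P : FinitePresentation G) : Group.IsFinitelyPresented G :=
  ⟨P.n, P.proj, P.proj_surjective, P.rels, P.rels_finite, P.normalClosure_rels⟩

end FinitePresentation

namespace FinitePresentation

variable {G : Type*} [Group G] (P : FinitePresentation G)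

/-! ### Correctness of Dehn's algorithm -/

section DehnAlgorithm

variable {P} {w w' : P.Word}

theorem Shortens.length_lt (h : P.Shortens w w') : w'.length < w.length := by
  obtain ⟨x, y, r₁, r₂, -, hlt, rfl, rfl⟩ := h
  simp only [List.length_append, FreeGroup.invRev_length]
  omega

theorem Shortens.proj_eq (h : P.Shortens w w') :
    P.proj (FreeGroup.mk w) = P.proj (FreeGroup.mk w') := by
  obtain ⟨x, y, r₁, r₂, ⟨r, hr, hr'⟩, -, rfl, rfl⟩ := h
  have h₁ : P.proj (FreeGroup.mk r₁) * P.proj (FreeGroup.mk r₂) = 1 := by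
    rw [← map_mul, FreeGroup.mul_mk, ← hr', FreeGroup.mk_toWord, P.proj_rel hr]
  have h₂ : P.proj (FreeGroup.mk r₁) = P.proj (FreeGroup.mk (FreeGroup.invRev r₂)) := by
    rw [← FreeGroup.inv_mk, map_inv]
    exact eq_inv_of_mul_eq_one_left h₁
  simp only [← FreeGroup.mul_mk, map_mul, h₂]

theorem DehnStep.length_lt (h : P.DehnStep w w') : w'.length < w.length := by
  rcases h with h | h
  · have := h.length
    omega
  · exact h.length_lt

theorem DehnStep.proj_eq (h : P.DehnStep w w') :
    P.proj (FreeGroup.mk w) = P.proj (FreeGroup.mk w') := by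
  rcases h with h | h
  · rw [FreeGroup.Red.exact.2 ⟨w', h.to_red, Relation.ReflTransGen.refl⟩]
  · exact h.proj_eq

theorem DehnStep.trivial_iff (h : P.DehnStep w w') : P.Trivial w ↔ P.Trivial w' := by
  unfold Trivial
  rw [h.proj_eq]

/-- A word that no step shortens is empty if it represents the identity. -/
theorem IsDehn.eq_nil (hP : P.IsDehn) (hw : ∀ w', ¬ P.DehnStep w w') (h : P.Trivial w) :
    w = [] := by
  have hred : (FreeGroup.mk w).toWord = w := by
    rw [FreeGroup.toWord_mk]
    have : FreeGroup.Red w (FreeGroup.reduce w) := FreeGroup.reduce.red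
    rcases this.cases_head with h | ⟨v, h, -⟩
    · exact h.symm
    · exact absurd (Or.inl h) (hw v)
  by_contra hne
  have h1 : FreeGroup.mk w ≠ 1 := by
    intro h
    rw [h, FreeGroup.toWord_one] at hred
    exact hne hred.symm
  obtain ⟨x, y, r₁, r₂, hr, hlt, hw'⟩ := hP _ h1 h
  rw [hred] at hw'
  exact hw _ (Or.inr ⟨x, y, r₁, r₂, hr, hlt, hw', rfl⟩)

theorem IsDehn.dehnAlgorithmCorrect (hP : P.IsDehn) : P.DehnAlgorithmCorrect := by
  refine fun w => ⟨fun k s h0 hs => ?_, fun w' hw hfinal => ?_⟩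
  · have key : ∀ i ≤ k, i + (s i).length ≤ w.length := by
      intro i
      induction i with
      | zero => intro _; rw [h0]; omega
      | succ i ih =>
        intro hi
        have := ih (by omega)
        have := (hs i hi).length_lt
        omega
    have := key k le_rfl
    omega
  · have key : P.Trivial w ↔ P.Trivial w' := by
      clear hfinal
      induction hw with
      | refl => rfl
      | tail _ h ih => exact ih.trans h.trivial_iff
    rw [key]
    refine ⟨?_, hP.eq_nil hfinal⟩
    rintro rfl
    simp [Trivial, ← FreeGroup.one_eq_mk]

end DehnAlgorithm

end FinitePresentation

/-! ### Length-reducing rewriting systems are primitive recursive -/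

section Rewriting

variable {β : Type*} [DecidableEq β]

/-- Replace the first occurrence of `u` in a word by `v`. -/
def replaceFirst (u v : List β) : List β → List β
  | [] => []
  | a :: t => if u <+: a :: t then v ++ (a :: t).drop u.length else a :: replaceFirst u v t

variable {u v : List β}

theorem replaceFirst_eq_or (w : List β) : replaceFirst u v w = w ∨
    ∃ x y, w = x ++ u ++ y ∧ replaceFirst u v w = x ++ v ++ y := by
  induction w with
  | nil => exact Or.inl rfl
  | cons a t ih =>
    unfold replaceFirst
    split_ifs with h
    · obtain ⟨y, hy⟩ := h
      refine Or.inr ⟨[], y, hy.symm, ?_⟩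
      rw [← hy]
      simp
    · rcases ih with h | ⟨x, y, h, h'⟩
      · exact Or.inl (by rw [h])
      · exact Or.inr ⟨a :: x, y, by simp [h], by simp [h']⟩

theorem length_replaceFirst_lt (hlt : v.length < u.length) (x y : List β) :
    (replaceFirst u v (x ++ u ++ y)).length < (x ++ u ++ y).length := by
  induction x with
  | nil =>
    obtain ⟨a, t, ht⟩ : ∃ a t, u ++ y = a :: t := by
      cases u with
      | nil => simp at hlt
      | cons a t => exact ⟨a, t ++ y, rfl⟩
    have h : u <+: a :: t := ⟨y, ht⟩
    rw [List.nil_append, ht, replaceFirst, if_pos h, ← ht]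
    simpa using hlt
  | cons a x ih =>
    rw [List.cons_append, List.cons_append, replaceFirst]
    split_ifs with h
    · obtain ⟨z, hz⟩ := h
      rw [← hz]
      simpa using hlt
    · simpa using ih

theorem primrec_replaceFirst [Primcodable β] (u v : List β) :
    Primrec (replaceFirst u v) := by
  have hpre : PrimrecPred fun w : List β => u <+: w := by
    have h : Primrec fun w : List β => w.take u.length :=
      Primrec.list_take.comp (Primrec.const _) Primrec.id
    refine (Primrec.eq.comp h (Primrec.const u)).of_eq fun w => ?_
    rw [List.prefix_iff_eq_take, eq_comm]
  have hcons : Primrec fun p : List β × β × List β × List β => p.2.1 :: p.2.2.1 :=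
    Primrec.list_cons.comp (Primrec.fst.comp Primrec.snd)
      (Primrec.fst.comp (Primrec.snd.comp Primrec.snd))
  have hcons' : Primrec fun p : List β × β × List β × List β => p.2.1 :: p.2.2.2 :=
    Primrec.list_cons.comp (Primrec.fst.comp Primrec.snd)
      (Primrec.snd.comp (Primrec.snd.comp Primrec.snd))
  have hstep : Primrec₂ fun (_ : List β) (p : β × List β × List β) =>
      if u <+: p.1 :: p.2.1 then v ++ (p.1 :: p.2.1).drop u.length else p.1 :: p.2.2 :=
    Primrec.ite (hpre.comp hcons)
      (Primrec.list_append.comp (Primrec.const v)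
        (Primrec.list_drop.comp (Primrec.const u.length) hcons)) hcons'
  refine (Primrec.list_rec Primrec.id (Primrec.const []) hstep).of_eq fun w => ?_
  induction w with
  | nil => rfl
  | cons a t ih =>
    simp only [id] at ih ⊢
    rw [replaceFirst, ← ih]

/-- Apply each rule of a finite system once. -/
def rewritePass (rules : List (List β × List β)) (w : List β) : List β :=
  rules.foldl (fun w r => replaceFirst r.1 r.2 w) w

theorem primrec_rewritePass [Primcodable β] (rules : List (List β × List β)) :
    Primrec (rewritePass rules) := by
  induction rules with
  | nil => exact Primrec.id
  | cons r rules ih => exact ih.comp (primrec_replaceFirst r.1 r.2)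

variable {rules : List (List β × List β)}

theorem length_replaceFirst_le {r : List β × List β} (h : r.2.length < r.1.length) (w : List β) :
    (replaceFirst r.1 r.2 w).length ≤ w.length := by
  rcases replaceFirst_eq_or (u := r.1) (v := r.2) w with h' | ⟨x, y, h', -⟩
  · rw [h']
  · subst h'
    exact (length_replaceFirst_lt h x y).le

theorem length_rewritePass_le (h : ∀ r ∈ rules, r.2.length < r.1.length) (w : List β) :
    (rewritePass rules w).length ≤ w.length := by
  induction rules generalizing w with
  | nil => exact le_rfl
  | cons r rules ih =>
    exact (ih (fun r' hr' => h r' (List.mem_cons_of_mem _ hr')) _).trans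
      (length_replaceFirst_le (h r List.mem_cons_self) w)

/-- Every successful replacement shortens, so a pass that does not shorten has found no occurrence
of any rule; stable words are therefore irreducible. -/
theorem rewritePass_eq_or (h : ∀ r ∈ rules, r.2.length < r.1.length) (w : List β) :
    (rewritePass rules w).length < w.length ∨
      rewritePass rules w = w ∧ ∀ r ∈ rules, ∀ x y, w ≠ x ++ r.1 ++ y := by
  induction rules generalizing w with
  | nil => exact Or.inr ⟨rfl, by simp⟩
  | cons r rules ih =>
    have hr := h r List.mem_cons_self
    have h' : ∀ r ∈ rules, r.2.length < r.1.length := fun r' hr' => h r' (List.mem_cons_of_mem _ hr')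
    by_cases hw : ∃ x y, w = x ++ r.1 ++ y
    · obtain ⟨x, y, rfl⟩ := hw
      exact Or.inl ((length_rewritePass_le h' _).trans_lt (length_replaceFirst_lt hr x y))
    · push Not at hw
      have hw' : replaceFirst r.1 r.2 w = w := by
        rcases replaceFirst_eq_or (u := r.1) (v := r.2) w with h | ⟨x, y, h, -⟩
        exacts [h, absurd h (hw x y)]
      have hpass : rewritePass (r :: rules) w = rewritePass rules w := by
        change rewritePass rules (replaceFirst r.1 r.2 w) = _
        rw [hw']
      rw [hpass]
      rcases ih h' w with h | ⟨h, h''⟩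
      · exact Or.inl h
      · refine Or.inr ⟨h, fun r' hr' => ?_⟩
        rcases List.mem_cons.1 hr' with rfl | hr'
        exacts [hw, h'' r' hr']

/-- As many passes as the word has letters leave a word to which no rule applies. -/
theorem rewritePass_iterate (h : ∀ r ∈ rules, r.2.length < r.1.length) (n : ℕ) (w : List β)
    (hn : w.length ≤ n) : ∀ r ∈ rules, ∀ x y, (rewritePass rules)^[n] w ≠ x ++ r.1 ++ y := by
  induction n generalizing w with
  | zero =>
    intro r hr x y hw
    have h₁ := h r hr
    have h₂ := congrArg List.length hw
    simp only [Function.iterate_zero, id, List.length_append] at h₂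
    omega
  | succ n ih =>
    rw [Function.iterate_succ_apply]
    rcases rewritePass_eq_or h w with h' | ⟨h', h''⟩
    · exact ih _ (by omega)
    · have : (rewritePass rules)^[n] w = w := Function.iterate_fixed h' n
      rw [h', this]
      exact h''

theorem rewritePass_iterate_induction {p : List β → Prop}
    (hp : ∀ r ∈ rules, ∀ x y, p (x ++ r.1 ++ y) ↔ p (x ++ r.2 ++ y)) (n : ℕ) (w : List β) :
    p ((rewritePass rules)^[n] w) ↔ p w := by
  have hpass : ∀ w, p (rewritePass rules w) ↔ p w := by
    clear w
    induction rules with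
    | nil => exact fun w => Iff.rfl
    | cons r rules ih =>
      intro w
      refine (ih (fun r' hr' => hp r' (List.mem_cons_of_mem _ hr')) _).trans ?_
      change p (replaceFirst r.1 r.2 w) ↔ p w
      rcases replaceFirst_eq_or (u := r.1) (v := r.2) w with h | ⟨x, y, h, h'⟩
      · rw [h]
      · rw [h', h, hp r List.mem_cons_self]
  induction n generalizing w with
  | zero => rfl
  | succ n ih =>
    rw [Function.iterate_succ_apply]
    exact (ih _).trans (hpass w)

end Rewriting

namespace FinitePresentation

variable {G : Type*} [Group G] {P : FinitePresentation G}

/-- The steps of Dehn's algorithm form a finite rewriting system. -/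
theorem exists_dehn_rules (P : FinitePresentation G) : ∃ rules : List (P.Word × P.Word),
    (∀ r ∈ rules, r.2.length < r.1.length) ∧
    (∀ r ∈ rules, ∀ x y, P.DehnStep (x ++ r.1 ++ y) (x ++ r.2 ++ y)) ∧
    ∀ w w', P.DehnStep w w' → ∃ r ∈ rules, ∃ x y, w = x ++ r.1 ++ y := by
  -- Two kinds of rules: deletion of an inverse pair, and, for each relator cut after `k` letters
  -- with the tail shorter than the head, replacement of the head by the inverse of the tail.
  have hfin : (Set.range (fun a : Fin P.n × Bool => (([a, (a.1, !a.2)], []) : P.Word × P.Word)) ∪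
      ((⋃ r ∈ P.rels, (fun k => ((r.toWord.take k, FreeGroup.invRev (r.toWord.drop k)) :
        P.Word × P.Word)) '' Set.Iic r.toWord.length) ∩ {r | r.2.length < r.1.length})).Finite :=
    (Set.finite_range _).union
      ((P.rels_finite.biUnion fun r _ => (Set.finite_Iic _).image _).inter_of_left _)
  refine ⟨hfin.toFinset.toList, ?_, ?_, ?_⟩
  · intro r hr
    rw [Finset.mem_toList, Set.Finite.mem_toFinset] at hr
    rcases hr with ⟨a, rfl⟩ | ⟨-, h⟩
    exacts [by simp, h]
  · intro r hr x y
    rw [Finset.mem_toList, Set.Finite.mem_toFinset] at hr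
    rcases hr with ⟨a, rfl⟩ | ⟨h, hlt⟩
    · refine Or.inl ?_
      have := FreeGroup.Red.Step.not (L₁ := x) (L₂ := y) (x := a.1) (b := a.2)
      simpa using this
    · simp only [Set.mem_iUnion] at h
      obtain ⟨s, hs, k, hk, rfl⟩ := h
      refine Or.inr ⟨x, y, s.toWord.take k, s.toWord.drop k, ⟨s, hs, by simp⟩, ?_, rfl, rfl⟩
      simpa only [Set.mem_ofPred_eq, FreeGroup.invRev_length] using hlt
  · intro w w' h
    simp only [Finset.mem_toList, Set.Finite.mem_toFinset]
    rcases h with h | ⟨x, y, r₁, r₂, ⟨r, hr, hr'⟩, hlt, rfl, -⟩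
    · cases h with
      | @not L₁ L₂ i b => exact ⟨_, Or.inl ⟨(i, b), rfl⟩, L₁, L₂, by simp⟩
    · refine ⟨(r₁, FreeGroup.invRev r₂), Or.inr ⟨?_, by simpa using hlt⟩, x, y, rfl⟩
      simp only [Set.mem_iUnion]
      exact ⟨r, hr, r₁.length, by simp [hr'], by simp [hr']⟩

/-- The order of the steps does not matter, so a fixed schedule decides triviality: sweep through
the rules as often as the word has letters, then test for the empty word. -/
theorem IsDehn.primrecPred_trivial (hP : P.IsDehn) : PrimrecPred P.Trivial := by
  obtain ⟨rules, h₁, h₂, h₃⟩ := P.exists_dehn_rules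
  have hprim : Primrec fun w : P.Word => (rewritePass rules)^[w.length] w :=
    Primrec.nat_iterate Primrec.list_length Primrec.id
      ((primrec_rewritePass rules).comp Primrec.snd).to₂
  refine (Primrec.eq.comp hprim (Primrec.const [])).of_eq fun w => ?_
  rw [← rewritePass_iterate_induction (rules := rules) (p := P.Trivial)
    (fun r hr x y => (h₂ r hr x y).trivial_iff) w.length w]
  refine ⟨fun h => ?_, hP.eq_nil fun w' hw' => ?_⟩
  · rw [h]
    simp [Trivial, ← FreeGroup.one_eq_mk]
  · obtain ⟨r, hr, x, y, h⟩ := h₃ _ _ hw'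
    exact rewritePass_iterate h₁ _ w le_rfl r hr x y h

/-- A word in the generators of `Q` is translated letter by letter into those of `P`. The alphabet
is finite, so the translation is primitive recursive. -/
theorem IsDehn.wordProblemSolvable (hP : P.IsDehn) (Q : FinitePresentation G) :
    Q.WordProblemSolvable := by
  obtain ⟨φ, hφ⟩ := exists_lift Q P
  have hprim : Primrec fun w : Q.Word =>
      w.flatMap fun a => (φ (FreeGroup.mk [a])).toWord :=
    Primrec.list_flatMap Primrec.id
      ((Primrec.dom_finite fun a => (φ (FreeGroup.mk [a])).toWord).comp Primrec.snd).to₂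
  refine PrimrecPred.computablePred ((hP.primrecPred_trivial.comp hprim).of_eq fun w => ?_)
  unfold Trivial
  rw [← hφ]
  have : FreeGroup.mk (w.flatMap fun a => (φ (FreeGroup.mk [a])).toWord) =
      φ (FreeGroup.mk w) := by
    induction w with
    | nil => simp [← FreeGroup.one_eq_mk]
    | cons a w ih =>
      rw [List.flatMap_cons, ← FreeGroup.mul_mk, ih, FreeGroup.mk_toWord, ← map_mul,
        FreeGroup.mul_mk]
      rfl
  rw [this]

end FinitePresentation

/-! ### Geodesics in the realization of a graph -/

section RealizationVertices

variable {V : Type*} {Γ : SimpleGraph V} (hΓ : Γ.Connected)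

/-- The vertex `v`, described as a degenerate edge. -/
def EdgePoint.vertex (v : V) : EdgePoint hΓ where
  src := v
  tgt := v
  a := 0
  b := 0
  a_nonneg := le_rfl
  b_nonneg := le_rfl
  edge := Or.inl ⟨rfl, by simp⟩

/-- The vertex `v` as a point of the realization. -/
noncomputable def Realization.vertex (v : V) : Realization hΓ := SeparationQuotient.mk (EdgePoint.vertex hΓ v)

variable {hΓ}

theorem EdgePoint.IsEnd.dist_vertex_le {p : EdgePoint hΓ} {x : V} {c : ℝ} (h : p.IsEnd x c) :
    dist p (EdgePoint.vertex hΓ x) ≤ c := by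
  have h₁ := EdgePoint.through_le h (q := EdgePoint.vertex hΓ x) (y := x) (e := 0)
    (Or.inl ⟨rfl, rfl⟩)
  have h₂ := EdgePoint.pathDist_le_through p (EdgePoint.vertex hΓ x)
  rw [SimpleGraph.dist_self] at h₁
  change EdgePoint.pathDist _ _ ≤ c
  simp only [Nat.cast_zero, add_zero] at h₁
  exact h₂.trans h₁

namespace Realization

theorem dist_vertex (u v : V) : dist (vertex hΓ u) (vertex hΓ v) = Γ.dist u v := by
  change EdgePoint.pathDist (EdgePoint.vertex hΓ u) (EdgePoint.vertex hΓ v) = _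
  unfold EdgePoint.pathDist EdgePoint.through
  by_cases h : u = v
  · simp [EdgePoint.vertex, h]
  · simp [EdgePoint.vertex, h]

theorem exists_dist_vertex_le (x : Realization hΓ) : ∃ v, dist x (vertex hΓ v) ≤ 1 := by
  obtain ⟨p, rfl⟩ := SeparationQuotient.surjective_mk x
  refine ⟨p.src, ?_⟩
  have h : dist p (EdgePoint.vertex hΓ p.src) ≤ p.a :=
    EdgePoint.IsEnd.dist_vertex_le (Or.inl ⟨rfl, rfl⟩)
  have h₁ := p.b_nonneg
  refine h.trans ?_
  rcases p.edge with ⟨-, h⟩ | ⟨-, h⟩ <;> linarith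

open Classical in
/-- The point at distance `t` from the start of a walk of length at least `t`. -/
noncomputable def walkPoint {u v : V} (p : Γ.Walk u v) (t : ℝ) : Realization hΓ :=
  if h : ⌊t⌋₊ < p.length then
    SeparationQuotient.mk
      { src := p.getVert ⌊t⌋₊
        tgt := p.getVert (⌊t⌋₊ + 1)
        a := Int.fract t
        b := 1 - Int.fract t
        a_nonneg := Int.fract_nonneg t
        b_nonneg := sub_nonneg.2 (Int.fract_lt_one t).le
        edge := Or.inr ⟨p.adj_getVert_succ h, by ring⟩ }
  else vertex hΓ v

variable {u v : V} (p : Γ.Walk u v)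

theorem walkPoint_natCast {i : ℕ} (hi : i ≤ p.length) :
    walkPoint p (i : ℝ) = vertex hΓ (p.getVert i) := by
  rcases hi.lt_or_eq with h | h
  · rw [walkPoint, dif_pos (by simpa using h)]
    refine eq_of_dist_eq_zero (le_antisymm ?_ dist_nonneg)
    refine EdgePoint.IsEnd.dist_vertex_le (Or.inl ⟨by simp, by simp⟩)
  · rw [walkPoint, dif_neg (by simp [h]), h, SimpleGraph.Walk.getVert_length]

theorem dist_walkPoint_of_edge {i : ℕ} (hi : i < p.length) {s t : ℝ} (hs : (i : ℝ) ≤ s)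
    (hst : s ≤ t) (ht : t ≤ i + 1) :
    dist (walkPoint (hΓ := hΓ) p s) (walkPoint p t) ≤ t - s := by
  have hfloor : ∀ r : ℝ, (i : ℝ) ≤ r → r < i + 1 → ⌊r⌋₊ = i := fun r h₁ h₂ =>
    (Nat.floor_eq_iff ((Nat.cast_nonneg i).trans h₁)).2 ⟨h₁, h₂⟩
  have hfract : ∀ r : ℝ, (i : ℝ) ≤ r → r < i + 1 → Int.fract r = r - i := fun r h₁ h₂ =>
    Int.fract_eq_iff.2 ⟨by linarith, by linarith, i, by simp⟩
  rcases ht.lt_or_eq with ht | rfl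
  · have hs' := hst.trans_lt ht
    have ht' := hs.trans hst
    have h₁ : ⌊s⌋₊ = ⌊t⌋₊ := (hfloor s hs hs').trans (hfloor t ht' ht).symm
    have h₂ : ⌊s⌋₊ < p.length := by rwa [hfloor s hs hs']
    rw [walkPoint, dif_pos h₂, walkPoint, dif_pos (h₁ ▸ h₂)]
    change EdgePoint.pathDist _ _ ≤ _
    unfold EdgePoint.pathDist
    rw [if_pos ⟨by simp only [h₁], by simp only [h₁]⟩]
    simp only [hfract s hs hs', hfract t ht' ht]
    rw [abs_sub_comm, abs_of_nonneg] <;> linarith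
  · rw [show (i : ℝ) + 1 = ((i + 1 : ℕ) : ℝ) by push_cast; rfl, walkPoint_natCast p hi]
    rcases hst.lt_or_eq with hs' | rfl
    · rw [walkPoint, dif_pos (by rwa [hfloor s hs hs'])]
      refine (EdgePoint.IsEnd.dist_vertex_le (c := 1 - Int.fract s) (Or.inr ⟨?_, rfl⟩)).trans ?_
      · change p.getVert (i + 1) = p.getVert (⌊s⌋₊ + 1)
        rw [hfloor s hs hs']
      · rw [hfract s hs hs']
        push_cast
        linarith
    · rw [show (i : ℝ) + 1 = ((i + 1 : ℕ) : ℝ) by push_cast; rfl, walkPoint_natCast p hi]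
      simp

theorem dist_walkPoint_le {s t : ℝ} (hs : 0 ≤ s) (hst : s ≤ t) (ht : t ≤ p.length) :
    dist (walkPoint (hΓ := hΓ) p s) (walkPoint p t) ≤ t - s := by
  have key : ∀ m : ℕ, m ≤ p.length → ∀ s t : ℝ, 0 ≤ s → s ≤ t → t ≤ m →
      dist (walkPoint (hΓ := hΓ) p s) (walkPoint p t) ≤ t - s := by
    intro m
    induction m with
    | zero =>
      intro _ s t hs hst ht
      have : s = t := by
        push_cast at ht
        linarith
      simp [this]
    | succ m ih =>
      intro hm s t hs hst ht
      push_cast at ht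
      rcases le_total t m with h | h
      · exact ih (by omega) s t hs hst h
      · rcases le_total s m with h' | h'
        · have h₁ := ih (by omega) s m hs h' le_rfl
          have h₂ := dist_walkPoint_of_edge (hΓ := hΓ) p hm le_rfl h ht
          have h₃ := dist_triangle (walkPoint (hΓ := hΓ) p s) (walkPoint p m) (walkPoint p t)
          linarith
        · exact dist_walkPoint_of_edge p hm h' hst ht
  exact key _ le_rfl s t hs hst ht

/-- The walk is parametrized without stretching distances, and a strict loss between two of its
points would bring the ends closer than the length of the walk. -/
theorem dist_walkPoint (hp : p.length = Γ.dist u v) {s t : ℝ} (hs : s ∈ Set.Icc (0 : ℝ) p.length)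
    (ht : t ∈ Set.Icc (0 : ℝ) p.length) :
    dist (walkPoint (hΓ := hΓ) p s) (walkPoint p t) = |s - t| := by
  have key : ∀ s t : ℝ, 0 ≤ s → s ≤ t → t ≤ p.length →
      dist (walkPoint (hΓ := hΓ) p s) (walkPoint p t) = t - s := by
    intro s t hs hst ht
    refine le_antisymm (dist_walkPoint_le p hs hst ht) ?_
    have h₁ := dist_walkPoint_le (hΓ := hΓ) p le_rfl hs (hst.trans ht)
    have h₂ := dist_walkPoint_le (hΓ := hΓ) p (hs.trans hst) ht le_rfl
    have h₃ := dist_vertex (hΓ := hΓ) u v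
    have h₄ := walkPoint_natCast (hΓ := hΓ) p (Nat.zero_le _)
    have h₅ := walkPoint_natCast (hΓ := hΓ) p le_rfl
    rw [SimpleGraph.Walk.getVert_zero, Nat.cast_zero] at h₄
    rw [SimpleGraph.Walk.getVert_length] at h₅
    rw [← h₄, ← h₅, ← hp] at h₃
    have h₆ := dist_triangle4 (walkPoint (hΓ := hΓ) p 0) (walkPoint p s) (walkPoint p t)
      (walkPoint p p.length)
    linarith
  rcases le_total s t with h | h
  · rw [key s t hs.1 h ht.2, abs_sub_comm, abs_of_nonneg (by linarith)]
  · rw [dist_comm, key t s ht.1 h hs.2, abs_of_nonneg (by linarith)]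

theorem isGeodesicSegment_walk (hp : p.length = Γ.dist u v) :
    IsGeodesicSegment (vertex hΓ u) (vertex hΓ v)
      (walkPoint (hΓ := hΓ) p '' Set.Icc (0 : ℝ) p.length) := by
  have h₄ := walkPoint_natCast (hΓ := hΓ) p (Nat.zero_le _)
  have h₅ := walkPoint_natCast (hΓ := hΓ) p le_rfl
  rw [SimpleGraph.Walk.getVert_zero, Nat.cast_zero] at h₄
  rw [SimpleGraph.Walk.getVert_length] at h₅
  unfold IsGeodesicSegment
  rw [dist_vertex, ← hp]
  exact ⟨walkPoint p, h₄, h₅, fun s hs t ht => dist_walkPoint p hp hs ht, rfl⟩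

/-- A vertex between two others lies on a geodesic segment. -/
theorem exists_isGeodesicSegment {u x v : V} (h : Γ.dist u x + Γ.dist x v = Γ.dist u v) :
    ∃ σ, IsGeodesicSegment (vertex hΓ u) (vertex hΓ v) σ ∧ vertex hΓ x ∈ σ := by
  obtain ⟨p, hp⟩ := hΓ.exists_walk_length_eq_dist u x
  obtain ⟨q, hq⟩ := hΓ.exists_walk_length_eq_dist x v
  refine ⟨_, isGeodesicSegment_walk (p.append q) ?_, (p.length : ℝ), ?_, ?_⟩
  · rw [SimpleGraph.Walk.length_append, hp, hq, h]
  · simp [SimpleGraph.Walk.length_append]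
  · rw [walkPoint_natCast _ (by simp [SimpleGraph.Walk.length_append])]
    simp [SimpleGraph.Walk.getVert_append]

end Realization

theorem IsGeodesicSegment.dist_add {X : Type*} [MetricSpace X] {x y q : X} {σ : Set X}
    (h : IsGeodesicSegment x y σ) (hq : q ∈ σ) : dist x q + dist q y = dist x y := by
  obtain ⟨f, h0, h1, hf, rfl⟩ := h
  obtain ⟨t, ht, rfl⟩ := hq
  have h₁ := hf 0 ⟨le_rfl, dist_nonneg⟩ t ht
  have h₂ := hf t ht _ ⟨dist_nonneg, le_rfl⟩
  rw [h0, zero_sub, abs_neg, abs_of_nonneg ht.1] at h₁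
  rw [h1, abs_sub_comm, abs_of_nonneg (sub_nonneg.2 ht.2)] at h₂
  linarith

/-- A vertex on a geodesic from `u` to `v` is not further from `z` than it would be in a tree, up to
an error. -/
theorem ThinTriangles.dist_vertex_le {δ : ℝ} (h : ThinTriangles (Realization hΓ) δ)
    {u v x : V} (hx : Γ.dist u x + Γ.dist x v = Γ.dist u v) (z : V) :
    (Γ.dist x z : ℝ) ≤ 2 * δ + Γ.dist u z - Γ.dist u x ∨
      (Γ.dist x z : ℝ) ≤ 2 * δ + Γ.dist v z - Γ.dist v x := by
  obtain ⟨σ₁, h₁, hx₁⟩ := Realization.exists_isGeodesicSegment (hΓ := hΓ) hx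
  obtain ⟨σ₂, h₂, -⟩ := Realization.exists_isGeodesicSegment (hΓ := hΓ) (u := u) (x := u) (v := z)
    (by simp)
  obtain ⟨σ₃, h₃, -⟩ := Realization.exists_isGeodesicSegment (hΓ := hΓ) (u := v) (x := v) (v := z)
    (by simp)
  obtain ⟨q, hq, hd⟩ := h _ _ _ _ _ _ h₁ h₂ h₃ _ hx₁
  -- Go from `x` to `z` through `q`. Since `q` lies on a geodesic from `y` to `z` and within `δ` of
  -- `x`, the distance `d(q, z) = d(y, z) - d(y, q)` is at most `d(y, z) - d(y, x) + δ`.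
  have key : ∀ {y : V} {σ}, IsGeodesicSegment (Realization.vertex hΓ y) (Realization.vertex hΓ z) σ →
      q ∈ σ → (Γ.dist x z : ℝ) ≤ 2 * δ + Γ.dist y z - Γ.dist y x := by
    intro y σ hσ hq
    have h₄ := hσ.dist_add hq
    have h₅ := dist_triangle_right (Realization.vertex hΓ y) (Realization.vertex hΓ x) q
    have h₆ := dist_triangle (Realization.vertex hΓ x) q (Realization.vertex hΓ z)
    simp only [Realization.dist_vertex] at h₄ h₅ h₆
    linarith
  exact hq.imp (key h₂) (key h₃)

end RealizationVertices

/-! ### Closed local geodesics -/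

/-- In a graph with slim triangles, a closed path that is a geodesic on every stretch of length at
most `2 D` is trivial if `D` is large. -/
theorem eq_zero_of_local_geodesic_loop {V : Type*} {Γ : SimpleGraph V} {δ : ℝ} {D : ℕ}
    (hD : 2 * δ < D)
    (h : ∀ u v x : V, Γ.dist u x + Γ.dist x v = Γ.dist u v → ∀ z : V,
      (Γ.dist x z : ℝ) ≤ 2 * δ + Γ.dist u z - Γ.dist u x ∨
      (Γ.dist x z : ℝ) ≤ 2 * δ + Γ.dist v z - Γ.dist v x)
    (c : ℕ → V) (n : ℕ) (hn : c n = c 0)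
    (hc : ∀ s t, s ≤ t → t ≤ n → t ≤ s + 2 * D → Γ.dist (c s) (c t) = t - s) : n = 0 := by
  -- Here `c t` is a point of the loop farthest from its base point.
  obtain ⟨t, ht, hmax⟩ := Finset.exists_max_image (Finset.range (n + 1))
    (fun t => Γ.dist (c t) (c 0)) ⟨0, by simp⟩
  rw [Finset.mem_range] at ht
  have hmax' : ∀ s ≤ n, Γ.dist (c s) (c 0) ≤ Γ.dist (c t) (c 0) := fun s hs =>
    hmax s (Finset.mem_range.2 (by omega))
  -- `c t` is on a geodesic between the points `D` before and `D` after it, cut off at the ends of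
  -- the loop. An end that is not cut off would be farther from `c 0` than `c t`, as `D > 2 δ`. An
  -- end that is cut off equals `c 0`, and the estimate becomes `d ≤ 2 δ - d`.
  have hbound : (Γ.dist (c t) (c 0) : ℝ) ≤ δ := by
    have h₁ := hc (t - D) t (by omega) (by omega) (by omega)
    have h₂ := hc t (min (t + D) n) (by omega) (by omega) (by omega)
    have h₃ := hc (t - D) (min (t + D) n) (by omega) (by omega) (by omega)
    rcases h (c (t - D)) (c (min (t + D) n)) (c t) (by omega) (c 0) with h | h
    · rcases le_total D t with hDt | hDt
      · have h₄ : (Γ.dist (c (t - D)) (c 0) : ℝ) ≤ Γ.dist (c t) (c 0) := by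
          exact_mod_cast hmax' (t - D) (by omega)
        rw [show t - (t - D) = D by omega] at h₁
        rw [h₁] at h
        linarith
      · rw [show t - D = 0 by omega, SimpleGraph.dist_self,
          SimpleGraph.dist_comm (u := c 0) (v := c t)] at h
        push_cast at h
        linarith
    · rw [SimpleGraph.dist_comm (u := c (min (t + D) n)) (v := c t)] at h
      rcases le_total (t + D) n with hDt | hDt
      · have h₄ : (Γ.dist (c (min (t + D) n)) (c 0) : ℝ) ≤ Γ.dist (c t) (c 0) := by
          exact_mod_cast hmax' _ (by omega)
        rw [show min (t + D) n - t = D by omega] at h₂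
        rw [h₂] at h
        linarith
      · rw [show min (t + D) n = n by omega, hn, SimpleGraph.dist_self] at h
        push_cast at h
        linarith
  -- The loop stays within `δ` of its base point, but a geodesic stretch of length `D` starts there.
  -- If the loop is shorter than that, it is itself a geodesic with equal ends.
  rcases le_or_gt D n with hDn | hDn
  · have h₁ := hc 0 D (by omega) hDn (by omega)
    have h₂ := hmax' D hDn
    rw [SimpleGraph.dist_comm, h₁, Nat.sub_zero] at h₂
    have h₃ : (D : ℝ) ≤ Γ.dist (c t) (c 0) := by exact_mod_cast h₂
    have h₄ : (0 : ℝ) ≤ Γ.dist (c t) (c 0) := Nat.cast_nonneg _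
    linarith
  · have h₁ := hc 0 n (by omega) le_rfl (by omega)
    rw [hn, SimpleGraph.dist_self] at h₁
    omega

/-! ### Word metric and the Dehn presentation of a hyperbolic group -/

section WordMetric

variable {α G : Type*} [Group G] {S : Set G} {π : FreeGroup α →* G}
  (hS : S = Set.range fun a => π (FreeGroup.of a))

theorem mk_cons (a : α × Bool) (w : List (α × Bool)) :
    FreeGroup.mk (a :: w) = FreeGroup.mk [a] * FreeGroup.mk w := by
  rw [FreeGroup.mul_mk]
  rfl

include hS

theorem eq_or_adj_letter (x : G) (a : α × Bool) : x = x * π (FreeGroup.mk [a]) ∨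
    (SimpleGraph.mulCayley S).Adj x (x * π (FreeGroup.mk [a])) := by
  refine or_iff_not_imp_left.2 fun h => (SimpleGraph.mulCayley_adj' _ _ _).2 ⟨h, ?_⟩
  rw [hS]
  refine ⟨_, ⟨a.1, rfl⟩, ?_⟩
  obtain ⟨a, _ | _⟩ := a
  · have : FreeGroup.mk [(a, false)] = (FreeGroup.of a)⁻¹ := by
      simp [FreeGroup.of, FreeGroup.inv_mk, FreeGroup.invRev]
    rw [this]
    simp
  · exact Or.inl rfl

theorem exists_letter_of_adj {x y : G} (h : (SimpleGraph.mulCayley S).Adj x y) :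
    ∃ a, x * π (FreeGroup.mk [a]) = y := by
  rw [SimpleGraph.mulCayley_adj', hS] at h
  obtain ⟨-, _, ⟨a, rfl⟩, h | h⟩ := h
  · exact ⟨(a, true), h⟩
  · refine ⟨(a, false), ?_⟩
    have : FreeGroup.mk [(a, false)] = (FreeGroup.of a)⁻¹ := by
      simp [FreeGroup.of, FreeGroup.inv_mk, FreeGroup.invRev]
    rw [this, h]
    simp

theorem exists_word_of_walk {x y : G} (p : (SimpleGraph.mulCayley S).Walk x y) :
    ∃ w : List (α × Bool), w.length = p.length ∧ x * π (FreeGroup.mk w) = y := by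
  induction p with
  | nil => exact ⟨[], rfl, by simp [← FreeGroup.one_eq_mk]⟩
  | cons h p ih =>
    obtain ⟨w, hw, hw'⟩ := ih
    obtain ⟨a, ha⟩ := exists_letter_of_adj hS h
    refine ⟨a :: w, by simp [hw], ?_⟩
    rw [mk_cons, map_mul, ← mul_assoc, ha, hw']

variable (hcl : Subgroup.closure S = ⊤)

include hcl

theorem exists_geodesic_word (x y : G) : ∃ w : List (α × Bool),
    w.length = (SimpleGraph.mulCayley S).dist x y ∧ x * π (FreeGroup.mk w) = y := by
  obtain ⟨p, hp⟩ := (mulCayley_connected S hcl).exists_walk_length_eq_dist x y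
  obtain ⟨w, hw, hw'⟩ := exists_word_of_walk hS p
  exact ⟨w, hw.trans hp, hw'⟩

theorem dist_mul_word_le (x : G) (w : List (α × Bool)) :
    (SimpleGraph.mulCayley S).dist x (x * π (FreeGroup.mk w)) ≤ w.length := by
  induction w generalizing x with
  | nil => simp [← FreeGroup.one_eq_mk]
  | cons a w ih =>
    have h₁ := (mulCayley_connected S hcl).dist_triangle (u := x) (v := x * π (FreeGroup.mk [a]))
      (w := x * π (FreeGroup.mk (a :: w)))
    have h₂ : (SimpleGraph.mulCayley S).dist x (x * π (FreeGroup.mk [a])) ≤ 1 := by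
      rcases eq_or_adj_letter hS x a with h | h
      · rw [← h, SimpleGraph.dist_self]
        omega
      · rw [SimpleGraph.dist_eq_one_iff_adj.2 h]
    have h₃ := ih (x * π (FreeGroup.mk [a]))
    rw [mul_assoc, ← map_mul, ← mk_cons] at h₃
    rw [List.length_cons]
    omega

theorem dist_mul_left (g x y : G) :
    (SimpleGraph.mulCayley S).dist (g * x) (g * y) = (SimpleGraph.mulCayley S).dist x y := by
  have key : ∀ g x y : G,
      (SimpleGraph.mulCayley S).dist (g * x) (g * y) ≤ (SimpleGraph.mulCayley S).dist x y := by
    intro g x y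
    obtain ⟨w, hw, rfl⟩ := exists_geodesic_word hS hcl x y
    rw [← hw, ← mul_assoc]
    exact dist_mul_word_le hS hcl _ w
  refine le_antisymm (key g x y) ?_
  have := key g⁻¹ (g * x) (g * y)
  rwa [inv_mul_cancel_left, inv_mul_cancel_left] at this

/-- A nonempty word that represents the identity contains a short word that is not geodesic. -/
theorem exists_short_of_trivial {δ : ℝ} {D : ℕ} (hD : 2 * δ < D)
    (h : ThinTriangles (CayleySpace S hcl) δ) {w : List (α × Bool)} (hw : w ≠ [])
    (hw' : π (FreeGroup.mk w) = 1) : ∃ x r y, w = x ++ r ++ y ∧ r.length ≤ 2 * D ∧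
      (SimpleGraph.mulCayley S).dist 1 (π (FreeGroup.mk r)) < r.length := by
  -- Otherwise the prefixes of `w` trace a closed path that is geodesic at scale `2 * D`.
  by_contra! hgeo
  refine hw (List.length_eq_zero_iff.1 ?_)
  refine eq_zero_of_local_geodesic_loop hD (fun u v x hx z => h.dist_vertex_le hx z)
    (fun t => π (FreeGroup.mk (w.take t))) w.length ?_ fun s t hst ht htD => ?_
  · simp only [List.take_length, List.take_zero, hw']
    rw [← FreeGroup.one_eq_mk, map_one]
  · set r := (w.take t).drop s with hr
    have hrl : r.length = t - s := by
      rw [hr, List.length_drop, List.length_take, min_eq_left ht]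
    have hwt : w.take t = w.take s ++ r := by
      rw [hr, ← min_eq_left hst, ← List.take_take, min_eq_left hst, List.take_append_drop]
    have hwr : w = w.take s ++ r ++ w.drop t := by
      rw [← hwt, List.take_append_drop]
    have h₁ := hgeo _ _ _ hwr (by omega)
    have h₂ := dist_mul_word_le hS hcl 1 r
    rw [one_mul] at h₂
    rw [hwt, ← FreeGroup.mul_mk, map_mul]
    have h₃ := dist_mul_left hS hcl (π (FreeGroup.mk (w.take s))) 1 (π (FreeGroup.mk r))
    rw [mul_one] at h₃
    omega

/-- Close up a shortest non-geodesic subword `r₁` by a geodesic word for its inverse. As `r₁` has at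
most `2 * D` letters and the geodesic has fewer, the relator has at most `4 * D`. Minimality of `r₁`
is what makes the concatenation reduced. -/
theorem exists_mostOfRelator [DecidableEq α] {δ : ℝ} {D : ℕ} (hD : 2 * δ < D)
    (h : ThinTriangles (CayleySpace S hcl) δ) {w : FreeGroup α} (hw : w ≠ 1)
    (hw' : π w = 1) : ∃ x y r₁ r₂,
      (∃ r ∈ {r | π r = 1 ∧ r.norm ≤ 4 * D}, r.toWord = r₁ ++ r₂) ∧
      r₂.length < r₁.length ∧ w.toWord = x ++ r₁ ++ y := by
  classical
  have hex : ∃ k x r y, r.length = k ∧ w.toWord = x ++ r ++ y ∧ r.length ≤ 2 * D ∧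
      (SimpleGraph.mulCayley S).dist 1 (π (FreeGroup.mk r)) < r.length := by
    obtain ⟨x, r, y, hr⟩ := exists_short_of_trivial hS hcl hD h (w := w.toWord)
      (by simpa using hw) (by rwa [FreeGroup.mk_toWord])
    exact ⟨_, x, r, y, rfl, hr⟩
  obtain ⟨x, r₁, y, hk, hxy, hle, hlt⟩ := Nat.find_spec hex
  have hmin : ∀ x r y, w.toWord = x ++ r ++ y → r.length < r₁.length →
      r.length ≤ (SimpleGraph.mulCayley S).dist 1 (π (FreeGroup.mk r)) := by
    intro x r y hxy hr
    by_contra! hcon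
    exact Nat.find_min hex (hk ▸ hr) ⟨x, r, y, rfl, hxy, by omega, hcon⟩
  clear hk
  obtain ⟨q, hq, hq'⟩ := exists_geodesic_word hS hcl 1 (π (FreeGroup.mk r₁))
  rw [one_mul] at hq'
  set g := FreeGroup.mk q with hg
  have hgn : (g⁻¹).toWord.length ≤ q.length := by
    change (g⁻¹).norm ≤ _
    rw [FreeGroup.norm_inv_eq]
    exact FreeGroup.norm_mk_le
  have hred₁ : FreeGroup.IsReduced r₁ :=
    (FreeGroup.isReduced_toWord (x := w)).infix ⟨x, y, hxy.symm⟩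
  -- If the last letter of `r₁` cancelled, then `r₁` without it would represent an element whose
  -- distance from `1` drops by one as well, a shorter non-geodesic subword.
  have hred : FreeGroup.IsReduced (r₁ ++ (g⁻¹).toWord) := by
    refine List.isChain_append.2 ⟨hred₁, FreeGroup.isReduced_toWord, ?_⟩
    intro a ha b hb hab
    by_contra hne
    obtain ⟨r₁', rfl⟩ := List.getLast?_eq_some_iff.1 ha
    obtain ⟨r₂', hr₂'⟩ := List.head?_eq_some_iff.1 hb
    have hb' : b = (a.1, !a.2) := by
      refine Prod.ext hab.symm ?_
      cases h₁ : a.2 <;> cases h₂ : b.2 <;> simp_all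
    have h₁ : π (FreeGroup.mk r₁') = π (FreeGroup.mk r₂')⁻¹ := by
      have h₂ : FreeGroup.mk (r₁' ++ [a]) * g⁻¹ = FreeGroup.mk r₁' * FreeGroup.mk r₂' := by
        rw [← FreeGroup.mk_toWord (x := g⁻¹), hr₂', hb', FreeGroup.mul_mk, FreeGroup.mul_mk]
        have := FreeGroup.Red.Step.not (L₁ := r₁') (L₂ := r₂') (x := a.1) (b := a.2)
        exact (FreeGroup.Red.exact.2
          ⟨_, (by simpa using this.to_red), Relation.ReflTransGen.refl⟩)
      have h₃ := congrArg π h₂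
      rw [map_mul, map_inv, hq', mul_inv_cancel, map_mul] at h₃
      rw [map_inv]
      exact eq_inv_of_mul_eq_one_left h₃.symm
    have h₂ := hmin x r₁' ([a] ++ y) (by rw [hxy]; simp) (by simp)
    have h₃ := dist_mul_word_le hS hcl 1 (FreeGroup.invRev r₂')
    rw [one_mul, ← FreeGroup.inv_mk, ← h₁, FreeGroup.invRev_length] at h₃
    have h₄ := congrArg List.length hr₂'
    simp only [List.length_cons, List.length_append, List.length_nil] at h₄ hlt
    omega
  refine ⟨x, y, r₁, (g⁻¹).toWord, ⟨FreeGroup.mk (r₁ ++ (g⁻¹).toWord), ⟨?_, ?_⟩, ?_⟩, ?_, hxy⟩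
  · rw [← FreeGroup.mul_mk, FreeGroup.mk_toWord, map_mul, map_inv, hq', mul_inv_cancel]
  · refine FreeGroup.norm_mk_le.trans ?_
    rw [List.length_append]
    omega
  · rw [FreeGroup.toWord_mk, hred.reduce_eq]
  · omega

end WordMetric

/-- A hyperbolic group has a Dehn presentation. -/
theorem IsHyperbolicGroup.exists_isDehn {G : Type*} [Group G] (h : IsHyperbolicGroup G) :
    ∃ P : FinitePresentation G, P.IsDehn := by
  obtain ⟨S, hcl, hfin, δ, hδ, hthin⟩ := h
  have := hfin.to_subtype
  obtain ⟨n, ⟨e⟩⟩ := Finite.exists_equiv_fin S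
  set π : FreeGroup (Fin n) →* G := FreeGroup.lift fun i => (e.symm i : G) with hπ
  have hS : S = Set.range fun a => π (FreeGroup.of a) := by
    simp only [hπ, FreeGroup.lift_apply_of]
    rw [show (fun a => (e.symm a : G)) = Subtype.val ∘ e.symm from rfl, Set.range_comp,
      e.symm.range_eq_univ, Set.image_univ, Subtype.range_coe]
  have hsurj : Function.Surjective π := by
    intro g
    obtain ⟨w, -, hw⟩ := exists_geodesic_word hS hcl 1 g
    exact ⟨_, by rwa [one_mul] at hw⟩
  obtain ⟨D, hD⟩ := exists_nat_gt (2 * δ)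
  set R : Set (FreeGroup (Fin n)) := {r | π r = 1 ∧ r.norm ≤ 4 * D} with hR
  have hdehn : ∀ w, w ≠ 1 → π w = 1 → ∃ x y r₁ r₂, (∃ r ∈ R, r.toWord = r₁ ++ r₂) ∧
      r₂.length < r₁.length ∧ w.toWord = x ++ r₁ ++ y :=
    fun w hw hw' => exists_mostOfRelator hS hcl hD hthin hw hw'
  have hRfin : R.Finite := by
    refine ((List.finite_length_le (Fin n × Bool) (4 * D)).image FreeGroup.mk).subset ?_
    rintro r ⟨-, hr⟩
    exact ⟨r.toWord, hr, FreeGroup.mk_toWord⟩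
  -- That `R` normally generates the kernel is itself a consequence of the Dehn property, by the
  -- area bound.
  refine ⟨⟨n, π, R, hRfin, hsurj, le_antisymm ?_ fun w hw => ?_⟩, hdehn⟩
  · exact Subgroup.normalClosure_le_normal fun r hr => hr.1
  · exact (areaLE_norm_of_dehn π (fun r hr => hr.1) hdehn w hw).mem_normalClosure

/-! ### Discrete line integrals along chains -/

section Chains

variable {X : Type*} [MetricSpace X]

/-- There is a chain of `n` steps of length at most one from `x` to `y` along which the discrete
line integral of `f dg` is `a`. -/
inductive HasChain (f g : X → ℝ) : X → X → ℕ → ℝ → Prop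
  | nil (x : X) : HasChain f g x x 0 0
  | cons {x y z : X} {n : ℕ} {a : ℝ} (h : dist x y ≤ 1) (h' : HasChain f g y z n a) :
      HasChain f g x z (n + 1) ((f x + f y) / 2 * (g y - g x) + a)

namespace HasChain

variable {f g : X → ℝ} {x y z : X} {n m : ℕ} {a b : ℝ}

theorem append (h : HasChain f g x y n a) (h' : HasChain f g y z m b) :
    HasChain f g x z (n + m) (a + b) := by
  induction h with
  | nil => simpa using h'
  | cons hd _ ih =>
    have := HasChain.cons hd (ih h')
    rwa [← add_assoc, add_right_comm] at this

theorem single (h : dist x y ≤ 1) : HasChain f g x y 1 ((f x + f y) / 2 * (g y - g x)) := by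
  simpa using HasChain.cons (f := f) (g := g) h (HasChain.nil y)

/-- The trapezoid weight is symmetric in the ends of a step and the increment of `g` changes sign.
-/
theorem reverse (h : HasChain f g x y n a) : HasChain f g y x n (-a) := by
  induction h with
  | nil => simpa using HasChain.nil _
  | @cons x y z n a hd _ ih =>
    rw [dist_comm] at hd
    convert ih.append (HasChain.single (f := f) (g := g) hd) using 1
    ring

theorem of_vanishing {c : ℕ → X} (hc : ∀ i < n, dist (c i) (c (i + 1)) ≤ 1)
    (hf : ∀ i ≤ n, f (c i) = 0) : HasChain f g (c 0) (c n) n 0 := by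
  induction n with
  | zero => exact HasChain.nil _
  | succ n ih =>
    have := (ih (fun i hi => hc i (by omega)) fun i hi => hf i (by omega)).append
      (HasChain.single (f := f) (g := g) (hc n (by omega)))
    simpa [hf n (by omega), hf (n + 1) le_rfl] using this

end HasChain

/-- The discrete line integral of `f dg` around a closed chain of `n` steps is at most `C n`. -/
def ChainInequality (X : Type*) [MetricSpace X] (C : ℝ) : Prop :=
  ∀ f g : X → ℝ, LipschitzWith 1 f → LipschitzWith 1 g → ∀ (x : X) (n : ℕ) (a : ℝ),
    HasChain f g x x n a → |a| ≤ C * n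

/-- Any two points are joined by a chain of unit steps of almost optimal length. -/
def CoarselyGeodesic (X : Type*) [MetricSpace X] : Prop :=
  ∀ x y : X, ∃ (n : ℕ) (c : ℕ → X), (n : ℝ) ≤ dist x y + 4 ∧ c 0 = x ∧ c n = y ∧
    ∀ i < n, dist (c i) (c (i + 1)) ≤ 1

/-- The cone function with apex `p` and height `m`. -/
noncomputable def cone (p : X) (m : ℝ) (q : X) : ℝ := max 0 (m - dist p q)

theorem cone_eq_zero {p q : X} {m : ℝ} (h : m ≤ dist p q) : cone p m q = 0 :=
  max_eq_left (by linarith)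

theorem lipschitzWith_cone (p : X) (m : ℝ) : LipschitzWith 1 (cone p m) := by
  refine LipschitzWith.of_dist_le_mul fun q r => ?_
  rw [NNReal.coe_one, one_mul, Real.dist_eq]
  unfold cone
  have h₁ := dist_triangle p q r
  have h₂ := dist_triangle_right p q r
  have h₃ : |max 0 (m - dist p q) - max 0 (m - dist p r)| ≤
      |(m - dist p q) - (m - dist p r)| := by
    have := abs_max_sub_max_le_max 0 (m - dist p q) 0 (m - dist p r)
    simpa using this
  refine h₃.trans ?_
  rw [abs_le]
  constructor <;> linarith

/-- Each point of an almost shortest chain is within half its length of one of the ends, so the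
chain stays outside the ball of radius `m` about `p` when both ends are that much farther out. -/
theorem CoarselyGeodesic.exists_chain_cone (hX : CoarselyGeodesic X) (g : X → ℝ) {p x y : X}
    {m : ℝ} (hx : m + (dist x y + 4) / 2 ≤ dist p x) (hy : m + (dist x y + 4) / 2 ≤ dist p y) :
    ∃ n : ℕ, (n : ℝ) ≤ dist x y + 4 ∧ HasChain (cone p m) g x y n 0 := by
  obtain ⟨n, c, hn, rfl, rfl, hc⟩ := hX x y
  refine ⟨n, hn, HasChain.of_vanishing hc fun i hi => cone_eq_zero ?_⟩
  have h₁ : ∀ j k, j ≤ k → k ≤ n → dist (c j) (c k) ≤ (k : ℝ) - j := by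
    intro j k hjk hk
    have := dist_le_Ico_sum_of_dist_le (f := c) hjk (d := fun _ => 1)
      (fun {i} _ hi => hc i (by omega))
    simpa [Nat.cast_sub hjk] using this
  have h₂ := h₁ 0 i (by omega) hi
  have h₃ := h₁ i n hi le_rfl
  have h₄ := dist_triangle_right p (c 0) (c i)
  have h₅ := dist_triangle p (c i) (c n)
  push_cast at h₂
  rcases le_total (i : ℝ) (n / 2 : ℝ) with h | h <;> linarith

section Geodesic

variable {γ : ℝ → X} {L : ℝ}

theorem exists_chain_geodesic
    (hγ : ∀ s ∈ Set.Icc 0 L, ∀ t ∈ Set.Icc 0 L, dist (γ s) (γ t) = |s - t|) (f g : X → ℝ)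
    {s t : ℝ} (hs : 0 ≤ s) (hst : s ≤ t) (ht : t ≤ L) (hf : ∀ r ∈ Set.Icc s t, f (γ r) = 0) :
    ∃ n : ℕ, (n : ℝ) ≤ t - s + 1 ∧ HasChain f g (γ s) (γ t) n 0 := by
  have hn : t ≤ s + ⌈t - s⌉₊ := by
    have := Nat.le_ceil (t - s)
    linarith
  -- Sample at unit steps; the minimum stops the last, possibly shorter, step at `t`.
  have hmem : ∀ i : ℕ, min (s + i) t ∈ Set.Icc s t := fun i =>
    ⟨le_min (by simp) hst, min_le_right _ _⟩
  have key := HasChain.of_vanishing (f := f) (g := g) (n := ⌈t - s⌉₊)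
    (c := fun i : ℕ => γ (min (s + i) t)) (fun i _ => ?_) (fun i _ => hf _ (hmem i))
  · refine ⟨_, (Nat.ceil_lt_add_one (by linarith)).le, ?_⟩
    simpa [min_eq_right hn, hst] using key
  · rw [hγ _ ⟨hs.trans (hmem _).1, (hmem _).2.trans ht⟩ _
      ⟨hs.trans (hmem _).1, (hmem _).2.trans ht⟩]
    have := abs_min_sub_min_le_max (s + i) t (s + (i + 1 : ℕ)) t
    refine this.trans ?_
    simp

theorem exists_chain_geodesic'
    (hγ : ∀ s ∈ Set.Icc 0 L, ∀ t ∈ Set.Icc 0 L, dist (γ s) (γ t) = |s - t|) (f g : X → ℝ)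
    {s t : ℝ} (hs : s ∈ Set.Icc 0 L) (ht : t ∈ Set.Icc 0 L)
    (hf : ∀ r ∈ Set.Icc 0 L, f (γ r) = 0) :
    ∃ n : ℕ, (n : ℝ) ≤ dist (γ s) (γ t) + 1 ∧ HasChain f g (γ s) (γ t) n 0 := by
  rw [hγ s hs t ht]
  rcases le_total s t with h | h
  · rw [abs_sub_comm, abs_of_nonneg (sub_nonneg.2 h)]
    exact exists_chain_geodesic hγ f g hs.1 h ht.2 fun r hr =>
      hf r ⟨hs.1.trans hr.1, hr.2.trans ht.2⟩
  · rw [abs_of_nonneg (sub_nonneg.2 h)]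
    obtain ⟨n, hn, h'⟩ := exists_chain_geodesic hγ f g ht.1 h hs.2 fun r hr =>
      hf r ⟨ht.1.trans hr.1, hr.2.trans hs.2⟩
    exact ⟨n, hn, by simpa using h'.reverse⟩

/-- The integral of a cone function of height `m` along a geodesic through its apex is `m ^ 2`. -/
theorem hasChain_cone
    (hγ : ∀ s ∈ Set.Icc 0 L, ∀ t ∈ Set.Icc 0 L, dist (γ s) (γ t) = |s - t|) {c : ℝ} {m : ℕ}
    (hm : 0 ≤ c - m) (hm' : c + m ≤ L) :
    HasChain (cone (γ c) m) (dist (γ 0)) (γ (c - m)) (γ (c + m)) (2 * m) (m ^ 2) := by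
  have hm0 : (0 : ℝ) ≤ m := Nat.cast_nonneg m
  have hc : c ∈ Set.Icc 0 L := ⟨by linarith, by linarith⟩
  have hg : ∀ t ∈ Set.Icc 0 L, dist (γ 0) (γ t) = t := by
    intro t ht
    rw [hγ 0 ⟨le_rfl, ht.1.trans ht.2⟩ t ht, zero_sub, abs_neg, abs_of_nonneg ht.1]
  -- On each side of the apex the cone is linear along `γ`, so the trapezoid rule is exact and `j *
  -- m - j ^ 2 / 2` is the integral of `m - r` over `[0, j]`.
  have hl : ∀ j : ℕ, j ≤ m → HasChain (cone (γ c) m) (dist (γ 0)) (γ (c - j)) (γ c) j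
      (j * m - j ^ 2 / 2) := by
    intro j
    induction j with
    | zero => intro _; simpa using HasChain.nil (γ c)
    | succ j ih =>
      intro hj
      have hj' : (j : ℝ) + 1 ≤ m := by exact_mod_cast hj
      have hj0 : (0 : ℝ) ≤ j := Nat.cast_nonneg j
      have h₁ : c - j ∈ Set.Icc 0 L := ⟨by linarith, by linarith [hc.2]⟩
      have h₂ : c - ((j : ℝ) + 1) ∈ Set.Icc 0 L := ⟨by linarith, by linarith [hc.2]⟩
      have hd : dist (γ (c - ((j : ℝ) + 1))) (γ (c - j)) ≤ 1 := by
        rw [hγ _ h₂ _ h₁, abs_le]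
        constructor <;> linarith
      have := HasChain.cons (f := cone (γ c) m) (g := dist (γ 0)) hd (ih (by omega))
      push_cast
      convert this using 1
      unfold cone
      rw [hg _ h₁, hg _ h₂, hγ _ hc _ h₁, hγ _ hc _ h₂, abs_of_nonneg (by linarith),
        abs_of_nonneg (by linarith), max_eq_right (by linarith), max_eq_right (by linarith)]
      ring
  have hr : ∀ j : ℕ, j ≤ m → HasChain (cone (γ c) m) (dist (γ 0)) (γ c) (γ (c + j)) j
      (j * m - j ^ 2 / 2) := by
    intro j
    induction j with
    | zero => intro _; simpa using HasChain.nil (γ c)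
    | succ j ih =>
      intro hj
      have hj' : (j : ℝ) + 1 ≤ m := by exact_mod_cast hj
      have hj0 : (0 : ℝ) ≤ j := Nat.cast_nonneg j
      have h₁ : c + j ∈ Set.Icc 0 L := ⟨by linarith [hc.1], by linarith⟩
      have h₂ : c + ((j : ℝ) + 1) ∈ Set.Icc 0 L := ⟨by linarith [hc.1], by linarith⟩
      have hd : dist (γ (c + j)) (γ (c + ((j : ℝ) + 1))) ≤ 1 := by
        rw [hγ _ h₁ _ h₂, abs_le]
        constructor <;> linarith
      have := (ih (by omega)).append (HasChain.single (f := cone (γ c) m) (g := dist (γ 0)) hd)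
      push_cast
      convert this using 1
      unfold cone
      rw [hg _ h₁, hg _ h₂, hγ _ hc _ h₁, hγ _ hc _ h₂, abs_of_nonpos (by linarith),
        abs_of_nonpos (by linarith), max_eq_right (by linarith), max_eq_right (by linarith)]
      ring
  convert (hl m le_rfl).append (hr m le_rfl) using 1
  · omega
  · ring

/-- A geodesic whose ends are joined by a chain far from its middle. -/
theorem ChainInequality.sq_le {C : ℝ} (hC : ChainInequality X C)
    (hγ : ∀ s ∈ Set.Icc 0 L, ∀ t ∈ Set.Icc 0 L, dist (γ s) (γ t) = |s - t|)
    {c s t : ℝ} {m n : ℕ} (hs : 0 ≤ s) (hsc : s ≤ c - m) (hct : c + m ≤ t) (ht : t ≤ L)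
    (h : HasChain (cone (γ c) m) (dist (γ 0)) (γ t) (γ s) n 0) :
    ∃ k : ℕ, (k : ℝ) ≤ n + (t - s) + 2 ∧ (m : ℝ) ^ 2 ≤ C * k := by
  have hm0 : (0 : ℝ) ≤ m := Nat.cast_nonneg m
  have hc : c ∈ Set.Icc 0 L := ⟨by linarith, by linarith⟩
  obtain ⟨n₁, hn₁, h₁⟩ := exists_chain_geodesic hγ (cone (γ c) m) (dist (γ 0)) hs hsc
    (by linarith) fun r hr => cone_eq_zero (by
      rw [hγ c hc r ⟨hs.trans hr.1, by linarith [hr.2]⟩, abs_of_nonneg] <;> linarith [hr.2])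
  obtain ⟨n₂, hn₂, h₂⟩ := exists_chain_geodesic hγ (cone (γ c) m) (dist (γ 0))
    (s := c + m) (by linarith [hc.1]) hct ht fun r hr => cone_eq_zero (by
      rw [hγ c hc r ⟨by linarith [hr.1, hc.1], hr.2.trans ht⟩, abs_sub_comm, abs_of_nonneg] <;>
        linarith [hr.1])
  have h₃ := hasChain_cone hγ (hs.trans hsc) (hct.trans ht)
  have h₄ := hC _ _ (lipschitzWith_cone _ _) (LipschitzWith.dist_right _) _ _ _
    (((h₁.append h₃).append h₂).append h)
  simp only [zero_add, add_zero] at h₄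
  refine ⟨_, ?_, (le_abs_self _).trans h₄⟩
  push_cast
  linarith

end Geodesic

/-- On the first side of a triangle, a point near the third side cannot come long before a point
near the second. -/
theorem sub_le_of_crossing {x y z p q r₂ r₃ : X} {s t L e₂ e₃ : ℝ} (hs : dist x p = s)
    (hs' : dist p y = L - s) (ht : dist x q = t) (ht' : dist q y = L - t)
    (h₂ : dist x r₂ + dist r₂ z = dist x z) (h₃ : dist y r₃ + dist r₃ z = dist y z)
    (he₂ : dist q r₂ ≤ e₂) (he₃ : dist p r₃ ≤ e₃) : t - s ≤ e₂ + e₃ := by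
  -- In the sum of these four inequalities all distances to `z` cancel, leaving twice the claim.
  have h₄ := dist_triangle_right x q r₂
  have h₅ := dist_triangle4 x p r₃ z
  have h₆ := dist_triangle_right y p r₃
  have h₇ := dist_triangle4 y q r₂ z
  rw [dist_comm y p] at h₆
  rw [dist_comm y q] at h₇
  linarith

/-- Some point of the second side is near the first and the third side. -/
theorem exists_center {σ₁ σ₃ : Set X} {γ : ℝ → X} {L D : ℝ} (hL : 0 ≤ L) (hD : 0 ≤ D)
    (hγ : ∀ s ∈ Set.Icc 0 L, ∀ t ∈ Set.Icc 0 L, dist (γ s) (γ t) = |s - t|)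
    (h0 : γ 0 ∈ σ₁) (h1 : γ L ∈ σ₃)
    (h : ∀ q ∈ γ '' Set.Icc 0 L, ∃ r ∈ σ₁ ∪ σ₃, dist q r ≤ D) :
    ∃ t ∈ Set.Icc 0 L, (∃ r ∈ σ₁, dist r (γ t) ≤ D) ∧ ∃ r ∈ σ₃, dist (γ t) r ≤ D + 1 := by
  have hmem : ∀ i : ℕ, min (i : ℝ) L ∈ Set.Icc 0 L := fun i =>
    ⟨le_min (Nat.cast_nonneg i) hL, min_le_right _ _⟩
  by_cases hall : ∀ i : ℕ, ∃ r ∈ σ₁, dist r (γ (min (i : ℝ) L)) ≤ D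
  · refine ⟨L, ⟨hL, le_rfl⟩, ?_, γ L, h1, by simpa using by linarith⟩
    simpa [min_eq_right (Nat.le_ceil L)] using hall ⌈L⌉₊
  · push Not at hall
    classical
    -- The first sample far from `σ₁` must be near `σ₃`; the sample before it is near `σ₁` and at
    -- most one unit away. It exists since the initial point lies on `σ₁`.
    have hfind := Nat.find_spec hall
    obtain ⟨k, hk⟩ : ∃ k, Nat.find hall = k + 1 := by
      refine Nat.exists_eq_succ_of_ne_zero fun h => ?_
      have := hfind _ h0
      rw [h, Nat.cast_zero, min_eq_left hL, dist_self] at this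
      linarith
    have hk' := Nat.find_min hall (m := k) (by omega)
    push Not at hk'
    refine ⟨_, hmem k, hk', ?_⟩
    obtain ⟨r, hr, hr'⟩ := h _ ⟨_, hmem (k + 1), rfl⟩
    rw [hk] at hfind
    have hr3 : r ∈ σ₃ := by
      rcases hr with hr | hr
      · have := hfind r hr
        rw [dist_comm] at this
        linarith
      · exact hr
    refine ⟨r, hr3, (dist_triangle _ (γ (min ((k + 1 : ℕ) : ℝ) L)) _).trans ?_⟩
    have h₁ : dist (γ (min (k : ℝ) L)) (γ (min ((k + 1 : ℕ) : ℝ) L)) ≤ 1 := by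
      rw [hγ _ (hmem k) _ (hmem (k + 1))]
      refine (abs_min_sub_min_le_max _ _ _ _).trans ?_
      simp
    linarith

end Chains

/-! ### From the chain inequality to thin triangles -/

section FatTriangles

variable {X : Type*} [MetricSpace X]

theorem IsGeodesicSegment.symm {x y : X} {σ : Set X} (h : IsGeodesicSegment x y σ) :
    IsGeodesicSegment y x σ := by
  obtain ⟨f, h0, h1, hf, rfl⟩ := h
  unfold IsGeodesicSegment
  rw [dist_comm y x]
  have hmem : ∀ t ∈ Set.Icc 0 (dist x y), dist x y - t ∈ Set.Icc 0 (dist x y) := fun t ht =>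
    ⟨by linarith [ht.2], by linarith [ht.1]⟩
  refine ⟨fun t => f (dist x y - t), by simpa using h1, by simpa using h0, fun s hs t ht => ?_, ?_⟩
  · rw [hf _ (hmem s hs) _ (hmem t ht), abs_sub_comm]
    congr 1
    ring
  · ext q
    constructor
    · rintro ⟨t, ht, rfl⟩
      exact ⟨_, hmem t ht, by simp⟩
    · rintro ⟨t, ht, rfl⟩
      exact ⟨_, hmem t ht, rfl⟩

theorem IsGeodesicSegment.left_mem {x y : X} {σ : Set X} (h : IsGeodesicSegment x y σ) :
    x ∈ σ := by
  obtain ⟨f, h0, h1, hf, rfl⟩ := h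
  exact ⟨0, ⟨le_rfl, dist_nonneg⟩, h0⟩

/-- A chain along a geodesic side on which the cone function vanishes. -/
theorem IsGeodesicSegment.exists_chain {x y q r : X} {σ : Set X} (h : IsGeodesicSegment x y σ)
    (hq : q ∈ σ) (hr : r ∈ σ) (f g : X → ℝ) (hf : ∀ q ∈ σ, f q = 0) :
    ∃ n : ℕ, (n : ℝ) ≤ dist q r + 1 ∧ HasChain f g q r n 0 := by
  obtain ⟨γ, h0, h1, hγ, rfl⟩ := h
  obtain ⟨s, hs, rfl⟩ := hq
  obtain ⟨t, ht, rfl⟩ := hr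
  exact exists_chain_geodesic' hγ f g hs ht fun r hr => hf _ ⟨r, hr, rfl⟩

/-- The ends `u`, `v` of a subsegment of the first side, near `u'`, `v'` on the other two, are joined
by a chain far from `p`, of length bounded in terms of `D`. -/
theorem exists_chain_via_center (hX : CoarselyGeodesic X) {x y z p : X} {σ₁ σ₂ σ₃ : Set X}
    (h₁ : IsGeodesicSegment x y σ₁) (h₂ : IsGeodesicSegment x z σ₂)
    (h₃ : IsGeodesicSegment y z σ₃) {D m : ℝ} (hD : 1 ≤ D)
    (hσ₂ : ∀ q ∈ σ₂, ∃ r ∈ σ₁ ∪ σ₃, dist q r ≤ D)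
    (hfar : ∀ q ∈ σ₂ ∪ σ₃, m + (D + 5) / 2 ≤ dist p q) (g : X → ℝ)
    {u v u' v' : X} (hu : u ∈ σ₁) (hv : v ∈ σ₁) (huv : dist x u ≤ dist x v)
    (hu' : u' ∈ σ₂) (hv' : v' ∈ σ₃) (hud : dist u u' ≤ D) (hvd : dist v v' ≤ D) :
    ∃ n : ℕ, (n : ℝ) ≤ 2 * dist u v + 20 * D + 10 ∧ HasChain (cone p m) g v' u' n 0 := by
  obtain ⟨γ₁, h10, h11, hγ₁, hσ₁⟩ := h₁
  obtain ⟨γ₂, h20, h21, hγ₂, hσ₂'⟩ := id h₂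
  -- The chain runs from `v'` along `σ₃` to `b`, jumps to the center `a` on `σ₂`, and follows `σ₂`
  -- to `u'`.
  obtain ⟨τ, hτ, ⟨c, hc, hcd⟩, b, hb, hbd⟩ := exists_center (σ₁ := σ₁) (σ₃ := σ₃)
    (D := D) (γ := γ₂) dist_nonneg (by linarith) hγ₂
    (by rw [h20, hσ₁, ← h10]; exact ⟨0, ⟨le_rfl, dist_nonneg⟩, rfl⟩)
    (by rw [h21]; exact h₃.symm.left_mem) (by rwa [← hσ₂'])
  have ha : γ₂ τ ∈ σ₂ := by rw [hσ₂']; exact ⟨τ, hτ, rfl⟩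
  set a := γ₂ τ
  rw [hσ₁] at hu hv hc
  obtain ⟨s, hs, rfl⟩ := hu
  obtain ⟨t, ht, rfl⟩ := hv
  obtain ⟨r, hr, rfl⟩ := hc
  have hx : ∀ t ∈ Set.Icc 0 (dist x y), dist x (γ₁ t) = t := by
    intro t ht
    have := hγ₁ 0 ⟨le_rfl, dist_nonneg⟩ t ht
    rwa [h10, zero_sub, abs_neg, abs_of_nonneg ht.1] at this
  have hy : ∀ t ∈ Set.Icc 0 (dist x y), dist (γ₁ t) y = dist x y - t := by
    intro t ht
    have := hγ₁ t ht _ ⟨dist_nonneg, le_rfl⟩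
    rwa [h11, abs_sub_comm, abs_of_nonneg (sub_nonneg.2 ht.2)] at this
  rw [hx s hs, hx t ht] at huv
  have hduv : dist (γ₁ s) (γ₁ t) = t - s := by
    rw [hγ₁ s hs t ht, abs_sub_comm, abs_of_nonneg (by linarith)]
  -- The point `c` is near both other sides, so by the crossing estimate it overshoots the segment
  -- from `u` to `v` by `O(D)` only; this bounds the length of the detour.
  have hrt : r - t ≤ 2 * D := by
    have := sub_le_of_crossing (hx t ht) (hy t ht) (hx r hr) (hy r hr) (h₂.dist_add ha)
      (h₃.dist_add hv') hcd hvd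
    linarith
  have hsr : s - r ≤ 3 * D + 1 := by
    have := sub_le_of_crossing (hx r hr) (hy r hr) (hx s hs) (hy s hs) (h₂.dist_add hu')
      (h₃.dist_add hb) hud (dist_triangle (γ₁ r) a b)
    linarith
  have hdcu : dist (γ₁ r) (γ₁ s) ≤ (t - s) + 3 * D + 1 := by
    rw [hγ₁ r hr s hs, abs_le]
    constructor <;> linarith
  have hdcv : dist (γ₁ r) (γ₁ t) ≤ (t - s) + 3 * D + 1 := by
    rw [hγ₁ r hr t ht, abs_le]
    constructor <;> linarith
  have hau : dist a u' ≤ (t - s) + 5 * D + 1 := by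
    have := dist_triangle4 a (γ₁ r) (γ₁ s) u'
    rw [dist_comm a (γ₁ r)] at this
    linarith
  have hvb : dist v' b ≤ (t - s) + 6 * D + 2 := by
    have h₄ := dist_triangle4 v' (γ₁ t) (γ₁ r) b
    have h₅ := dist_triangle (γ₁ r) a b
    rw [dist_comm v' (γ₁ t), dist_comm (γ₁ t) (γ₁ r)] at h₄
    linarith
  have hzero : ∀ q ∈ σ₂ ∪ σ₃, cone p m q = 0 := fun q hq =>
    cone_eq_zero (by linarith [hfar q hq])
  obtain ⟨n₁, hn₁, hc₁⟩ := h₃.exists_chain hv' hb (cone p m) g fun q hq => hzero q (Or.inr hq)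
  obtain ⟨n₂, hn₂, hc₂⟩ := h₂.exists_chain ha hu' (cone p m) g fun q hq => hzero q (Or.inl hq)
  have hba : dist b a ≤ D + 1 := by rwa [dist_comm]
  obtain ⟨n₃, hn₃, hc₃⟩ := hX.exists_chain_cone g (p := p) (x := b) (y := a) (m := m)
    (by linarith [hfar b (Or.inr hb)]) (by linarith [hfar a (Or.inl ha)])
  refine ⟨n₁ + n₃ + n₂, ?_, by simpa using (hc₁.append hc₃).append hc₂⟩
  push_cast
  rw [hduv]
  linarith

/-- A side of a geodesic triangle that is `D`-close to the other two, but has a point that is not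
`(D - 1)`-close, exists only for small `D`. -/
theorem ChainInequality.fat_le {C : ℝ} (hC0 : 0 ≤ C) (hC : ChainInequality X C)
    (hX : CoarselyGeodesic X) {x y z p : X} {σ₁ σ₂ σ₃ : Set X}
    (h₁ : IsGeodesicSegment x y σ₁) (h₂ : IsGeodesicSegment x z σ₂)
    (h₃ : IsGeodesicSegment y z σ₃) {D : ℕ} (hD : 16 ≤ D)
    (hσ₁ : ∀ q ∈ σ₁, ∃ r ∈ σ₂ ∪ σ₃, dist q r ≤ D)
    (hσ₂ : ∀ q ∈ σ₂, ∃ r ∈ σ₁ ∪ σ₃, dist q r ≤ D)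
    (hp : p ∈ σ₁) (hfar : ∀ q ∈ σ₂ ∪ σ₃, (D : ℝ) - 1 ≤ dist p q) : (D : ℝ) ≤ 1920 * C := by
  obtain ⟨γ, h0, h1, hγ, hσ⟩ := id h₁
  set L := dist x y with hL
  obtain ⟨c, hc, hpc⟩ : p ∈ γ '' Set.Icc 0 L := hσ ▸ hp
  have hD' : (16 : ℝ) ≤ D := by exact_mod_cast hD
  have hx : ∀ t ∈ Set.Icc 0 L, dist x (γ t) = t := by
    intro t ht
    have := hγ 0 ⟨le_rfl, dist_nonneg⟩ t ht
    rwa [h0, zero_sub, abs_neg, abs_of_nonneg ht.1] at this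
  have hy : ∀ t ∈ Set.Icc 0 L, dist (γ t) y = L - t := by
    intro t ht
    have := hγ t ht _ ⟨dist_nonneg, le_rfl⟩
    rwa [h1, abs_sub_comm, abs_of_nonneg (sub_nonneg.2 ht.2)] at this
  -- The largest cone height for which a jump of length `D + 1` between points at distance at least
  -- `D - 1` from `p` still avoids the cone: `m + (D + 5) / 2 ≤ D - 1`.
  obtain ⟨m, hm⟩ : ∃ m : ℕ, D = 2 * m + 7 ∨ D = 2 * m + 8 := ⟨(D - 7) / 2, by omega⟩
  have hmD : 2 * (m : ℝ) + 7 ≤ D := by exact_mod_cast (show 2 * m + 7 ≤ D by omega)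
  have hDm : (D : ℝ) ≤ 2 * m + 8 := by exact_mod_cast (show D ≤ 2 * m + 8 by omega)
  have hfar' : ∀ q ∈ σ₂ ∪ σ₃, (m : ℝ) + (D + 5) / 2 ≤ dist p q := fun q hq => by
    have := hfar q hq
    linarith
  have hzero : ∀ q ∈ σ₂ ∪ σ₃, cone p m q = 0 := fun q hq =>
    cone_eq_zero (by linarith [hfar' q hq])
  -- Only a window of radius `10 * D` about `p` is used, so that the loop has length `O(D)` however
  -- long the side is.
  set s := max 0 (c - 10 * D) with hs
  set t := min L (c + 10 * D) with ht
  have hsI : s ∈ Set.Icc 0 L := ⟨le_max_left _ _, max_le (hc.1.trans hc.2) (by linarith [hc.2])⟩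
  have htI : t ∈ Set.Icc 0 L := ⟨le_min (hc.1.trans hc.2) (by linarith [hc.1]), min_le_left _ _⟩
  have hsc : (s = 0 ∧ (D : ℝ) - 1 ≤ c) ∨ s = c - 10 * D := by
    refine (max_choice 0 (c - 10 * D)).imp (fun h => ⟨h, ?_⟩) id
    have := hfar x (Or.inl h₂.left_mem)
    rwa [← hpc, dist_comm, hx c hc] at this
  have htc : (t = L ∧ (D : ℝ) - 1 ≤ L - c) ∨ t = c + 10 * D := by
    refine (min_choice L (c + 10 * D)).imp (fun h => ⟨h, ?_⟩) id
    have := hfar y (Or.inr h₃.left_mem)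
    rwa [← hpc, hy c hc] at this
  have hsc' : s ≤ c - (D - 1) := by
    rcases hsc with h | h <;> linarith
  have htc' : c + (D - 1) ≤ t := by
    rcases htc with h | h <;> linarith
  have hst : t - s ≤ 20 * D := by
    have := le_max_right 0 (c - 10 * (D : ℝ))
    have := min_le_right L (c + 10 * (D : ℝ))
    linarith
  have hpu : (D : ℝ) - 1 ≤ dist p (γ s) := by
    rw [← hpc, hγ c hc s hsI]
    exact le_trans (by linarith) (le_abs_self _)
  have hpv : (D : ℝ) - 1 ≤ dist p (γ t) := by
    rw [← hpc, hγ c hc t htI]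
    exact le_trans (by linarith) (neg_le_abs _)
  have huv : dist (γ s) (γ t) = t - s := by
    rw [hγ s hsI t htI, abs_sub_comm, abs_of_nonneg (by linarith)]
  -- bridges from the ends of the window to the other sides
  have hbr : ∀ w, (D : ℝ) - 1 ≤ dist p w → ∀ w' ∈ σ₂ ∪ σ₃, dist w w' ≤ D →
      ∃ n : ℕ, (n : ℝ) ≤ D + 4 ∧ HasChain (cone p m) (dist (γ 0)) w w' n 0 := by
    intro w hw w' hw' hd
    obtain ⟨n, hn, h⟩ := hX.exists_chain_cone (dist (γ 0)) (p := p) (x := w) (y := w') (m := m)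
      (by linarith) (by linarith [hfar' w' hw'])
    exact ⟨n, by linarith, h⟩
  -- it is enough to join the far ends of the bridges
  have key : ∀ u' ∈ σ₂ ∪ σ₃, ∀ v' ∈ σ₂ ∪ σ₃, dist (γ s) u' ≤ D → dist (γ t) v' ≤ D →
      (∃ n : ℕ, (n : ℝ) ≤ 2 * (t - s) + 20 * D + 10 ∧
        HasChain (cone p m) (dist (γ 0)) v' u' n 0) → (D : ℝ) ≤ 1920 * C := by
    rintro u' hu' v' hv' hud hvd ⟨n, hn, hch⟩
    obtain ⟨n₁, hn₁, hc₁⟩ := hbr _ hpu u' hu' hud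
    obtain ⟨n₂, hn₂, hc₂⟩ := hbr _ hpv v' hv' hvd
    have hloop := (hc₂.append hch).append hc₁.reverse
    simp only [neg_zero, add_zero] at hloop
    rw [← hpc] at hloop
    obtain ⟨k, hk, hk'⟩ := hC.sq_le hγ hsI.1 (by linarith) (by linarith) htI.2 hloop
    -- The return chain, the two bridges and the window add up to at most `82 * D + 20`. With `D ≤ 4
    -- * m`, which needs `16 ≤ D`, the constant is `16 * 120 = 1920`.
    have hkD : (k : ℝ) ≤ 120 * D := by
      push_cast at hk
      linarith
    have hm4 : (D : ℝ) ≤ 4 * m := by linarith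
    have h₄ : (m : ℝ) ^ 2 ≤ C * (120 * D) := hk'.trans (by gcongr)
    have h₅ : (D : ℝ) * D ≤ (1920 * C) * D := by nlinarith
    exact le_of_mul_le_mul_right h₅ (by linarith)
  have hs₁ : γ s ∈ σ₁ := hσ ▸ ⟨s, hsI, rfl⟩
  have ht₁ : γ t ∈ σ₁ := hσ ▸ ⟨t, htI, rfl⟩
  have same : ∀ {w w' : X} {σ : Set X}, IsGeodesicSegment w w' σ → σ ⊆ σ₂ ∪ σ₃ →
      ∀ u' ∈ σ, ∀ v' ∈ σ, dist (γ s) u' ≤ D → dist (γ t) v' ≤ D → (D : ℝ) ≤ 1920 * C := by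
    intro w w' σ hseg hsub u' hu' v' hv' hud hvd
    refine key u' (hsub hu') v' (hsub hv') hud hvd ?_
    obtain ⟨n, hn, hch⟩ := hseg.exists_chain hv' hu' (cone p m) (dist (γ 0)) fun q hq =>
      hzero q (hsub hq)
    refine ⟨n, ?_, hch⟩
    have := dist_triangle4 v' (γ t) (γ s) u'
    rw [dist_comm v' (γ t), dist_comm (γ t) (γ s), huv] at this
    linarith
  obtain ⟨v', hv', hvd⟩ := hσ₁ _ ht₁
  by_cases hA : ∃ u' ∈ σ₂, dist (γ s) u' ≤ D
  · obtain ⟨u', hu', hud⟩ := hA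
    rcases hv' with hv' | hv'
    · exact same h₂ Set.subset_union_left u' hu' v' hv' hud hvd
    · refine key u' (Or.inl hu') v' (Or.inr hv') hud hvd ?_
      have := exists_chain_via_center hX h₁ h₂ h₃ (by linarith) hσ₂ hfar' (dist (γ 0)) hs₁ ht₁
        (by rw [hx s hsI, hx t htI]; linarith) hu' hv' hud hvd
      rwa [huv] at this
  · obtain ⟨u', hu', hud⟩ := hσ₁ _ hs₁
    have hu3 : u' ∈ σ₃ := hu'.resolve_left fun h => hA ⟨u', h, hud⟩
    -- The left end is near `σ₃` only, so it is not the corner `x` and the window has its full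
    -- length on that side. If the right end were near `σ₂`, the crossing estimate would give `t - s
    -- ≤ 2 * D`.
    have hs10 : s = c - 10 * D := by
      refine hsc.resolve_left fun h => hA ⟨x, h₂.left_mem, ?_⟩
      rw [h.1, h0, dist_self]
      linarith
    rcases hv' with hv' | hv'
    · have := sub_le_of_crossing (hx s hsI) (hy s hsI) (hx t htI) (hy t htI) (h₂.dist_add hv')
        (h₃.dist_add hu3) hvd hud
      linarith
    · exact same h₃ Set.subset_union_right u' hu3 v' hv' hud hvd

/-- A coarsely geodesic space with the chain inequality has thin triangles. -/
theorem ChainInequality.thinTriangles {C : ℝ} (hC0 : 0 ≤ C) (hC : ChainInequality X C)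
    (hX : CoarselyGeodesic X) : ThinTriangles X (1920 * C + 16) := by
  classical
  intro x y z σ₁ σ₂ σ₃ h₁ h₂ h₃
  have hex : ∃ D : ℕ, (∀ q ∈ σ₁, ∃ r ∈ σ₂ ∪ σ₃, dist q r ≤ D) ∧
      (∀ q ∈ σ₂, ∃ r ∈ σ₁ ∪ σ₃, dist q r ≤ D) ∧ ∀ q ∈ σ₃, ∃ r ∈ σ₁ ∪ σ₂, dist q r ≤ D := by
    obtain ⟨D, hD⟩ := exists_nat_ge (dist x y + dist x z + dist y z)
    have := dist_nonneg (x := x) (y := y)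
    have := dist_nonneg (x := x) (y := z)
    have := dist_nonneg (x := y) (y := z)
    refine ⟨D, fun q hq => ⟨x, Or.inl h₂.left_mem, ?_⟩, fun q hq => ⟨x, Or.inl h₁.left_mem, ?_⟩,
      fun q hq => ⟨y, Or.inl h₁.symm.left_mem, ?_⟩⟩
    · have := h₁.dist_add hq
      have := dist_nonneg (x := q) (y := y)
      rw [dist_comm]
      linarith
    · have := h₂.dist_add hq
      have := dist_nonneg (x := q) (y := z)
      rw [dist_comm]
      linarith
    · have := h₃.dist_add hq
      have := dist_nonneg (x := q) (y := z)
      rw [dist_comm]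
      linarith
  obtain ⟨hσ₁, hσ₂, hσ₃⟩ := Nat.find_spec hex
  -- One `D` serves all three sides, so closeness `D` is available everywhere while closeness `D -
  -- 1` fails on some side.
  set D := Nat.find hex with hDdef
  have hD : (D : ℝ) ≤ 1920 * C + 16 := by
    by_contra! hcon
    have hD16' : (16 : ℝ) ≤ D := by linarith
    have hD16 : 16 ≤ D := by exact_mod_cast hD16'
    have hmin := Nat.find_min hex (m := D - 1) (by omega)
    rw [Nat.cast_sub (by omega), Nat.cast_one] at hmin
    suffices (D : ℝ) ≤ 1920 * C by linarith
    by_contra hnot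
    refine hmin ⟨fun p hp => ?_, fun p hp => ?_, fun p hp => ?_⟩
    · by_contra! hfar
      exact hnot (hC.fat_le hC0 hX h₁ h₂ h₃ hD16 hσ₁ hσ₂ hp fun q hq => (hfar q hq).le)
    · by_contra! hfar
      exact hnot (hC.fat_le hC0 hX h₂ h₁ h₃.symm hD16 hσ₂ hσ₁ hp fun q hq => (hfar q hq).le)
    · by_contra! hfar
      rw [Set.union_comm] at hσ₂
      exact hnot (hC.fat_le hC0 hX h₃ h₁.symm h₂.symm hD16 hσ₃ (fun q hq => by
        rw [Set.union_comm]; exact hσ₁ q hq |>.imp fun r hr => hr) hp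
          fun q hq => (hfar q hq).le)
  intro p hp
  obtain ⟨q, hq, hd⟩ := hσ₁ p hp
  exact ⟨q, hq, hd.trans hD⟩

end FatTriangles

/-! ### Line integrals along words and their bound by area -/

section WordIntegral

variable {α G : Type*} [Group G] (π : FreeGroup α →* G) (f g : G → ℝ)

/-- The discrete line integral of `f dg` along the path in the Cayley graph that starts at `x` and
is labelled by a word. -/
noncomputable def wordIntegral : G → List (α × Bool) → ℝ
  | _, [] => 0
  | x, a :: w => (f x + f (x * π (FreeGroup.mk [a]))) / 2 * (g (x * π (FreeGroup.mk [a])) - g x) +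
      wordIntegral (x * π (FreeGroup.mk [a])) w

theorem wordIntegral_append (x : G) (v w : List (α × Bool)) :
    wordIntegral π f g x (v ++ w) =
      wordIntegral π f g x v + wordIntegral π f g (x * π (FreeGroup.mk v)) w := by
  induction v generalizing x with
  | nil => simp [wordIntegral, ← FreeGroup.one_eq_mk]
  | cons a v ih =>
    rw [List.cons_append, wordIntegral, wordIntegral, ih, mk_cons a v, map_mul, mul_assoc,
      add_assoc]

/-- An edge followed by its inverse contributes two opposite terms, so the integral is defined on
the free group. -/
theorem wordIntegral_step {v w : List (α × Bool)} (h : FreeGroup.Red.Step v w) (x : G) :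
    wordIntegral π f g x v = wordIntegral π f g x w := by
  cases h with
  | @not L₁ L₂ i b =>
    have hcancel : FreeGroup.mk [(i, b), (i, !b)] = 1 := by
      rw [FreeGroup.one_eq_mk]
      exact Quot.sound (FreeGroup.Red.Step.not (L₁ := []) (L₂ := []))
    have hmk : π (FreeGroup.mk [(i, b)]) * π (FreeGroup.mk [(i, !b)]) = 1 := by
      rw [← map_mul, ← mk_cons, hcancel, map_one]
    rw [wordIntegral_append, wordIntegral_append]
    congr 1
    rw [wordIntegral, wordIntegral, mul_assoc (x * _), hmk, mul_one]
    ring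

section

variable {π f g}

theorem abs_edge_sub_le {a b c d r s : ℝ} (ha : |a - c| ≤ r) (hb : |b - c| ≤ r) (hd : |d| ≤ s) :
    |(a + b) / 2 * d - c * d| ≤ r * s := by
  have h : |(a + b) / 2 - c| ≤ r := by
    rw [abs_le] at *
    constructor <;> linarith
  rw [← sub_mul, abs_mul]
  exact mul_le_mul h hd (abs_nonneg _) ((abs_nonneg _).trans h)

/-- Along the path `f` differs from `c` by at most `k + w.length`. On a closed path the subtracted
term vanishes, which gives a quadratic bound, used for the boundedly long relators. -/
theorem abs_wordIntegral_sub_le (hf : ∀ x a, |f (x * π (FreeGroup.mk [a])) - f x| ≤ 1)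
    (hg : ∀ x a, |g (x * π (FreeGroup.mk [a])) - g x| ≤ 1) (w : List (α × Bool)) (x : G)
    {c k : ℝ} (hc : |f x - c| ≤ k) :
    |wordIntegral π f g x w - c * (g (x * π (FreeGroup.mk w)) - g x)| ≤
      (k + w.length) * w.length := by
  induction w generalizing x k with
  | nil => simp [wordIntegral, ← FreeGroup.one_eq_mk]
  | cons a w ih =>
    set y := x * π (FreeGroup.mk [a]) with hy
    have hcy : |f y - c| ≤ k + 1 := by
      have := abs_sub_le (f y) (f x) c
      linarith [hf x a]
    have h₁ := abs_edge_sub_le (hc.trans (by linarith : k ≤ k + 1)) hcy (hg x a)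
    have h₂ := ih y hcy
    have h₃ : x * π (FreeGroup.mk (a :: w)) = y * π (FreeGroup.mk w) := by
      rw [mk_cons, map_mul, ← mul_assoc]
    rw [h₃, wordIntegral, ← hy, List.length_cons]
    push_cast
    rw [← hy] at h₁
    have h₄ := abs_add_le ((f x + f y) / 2 * (g y - g x) - c * (g y - g x))
      (wordIntegral π f g y w - c * (g (y * π (FreeGroup.mk w)) - g y))
    have h₅ : (f x + f y) / 2 * (g y - g x) + wordIntegral π f g y w -
        c * (g (y * π (FreeGroup.mk w)) - g x) =
        ((f x + f y) / 2 * (g y - g x) - c * (g y - g x)) +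
        (wordIntegral π f g y w - c * (g (y * π (FreeGroup.mk w)) - g y)) := by ring
    rw [h₅]
    have h₆ : (0 : ℝ) ≤ w.length := Nat.cast_nonneg _
    nlinarith

end

variable [DecidableEq α]

theorem wordIntegral_toWord_mk (x : G) (w : List (α × Bool)) :
    wordIntegral π f g x (FreeGroup.mk w).toWord = wordIntegral π f g x w := by
  rw [FreeGroup.toWord_mk]
  have h : FreeGroup.Red w (FreeGroup.reduce w) := FreeGroup.reduce.red
  generalize FreeGroup.reduce w = v at h
  induction h with
  | refl => rfl
  | tail _ h ih => rw [← wordIntegral_step π f g h, ih]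

theorem wordIntegral_toWord_mul (x : G) (v w : FreeGroup α) :
    wordIntegral π f g x (v * w).toWord =
      wordIntegral π f g x v.toWord + wordIntegral π f g (x * π v) w.toWord := by
  conv_lhs => rw [← FreeGroup.mk_toWord (x := v), ← FreeGroup.mk_toWord (x := w),
    FreeGroup.mul_mk, wordIntegral_toWord_mk, wordIntegral_append, FreeGroup.mk_toWord]

theorem wordIntegral_toWord_inv (x : G) {w : FreeGroup α} (hw : π w = 1) :
    wordIntegral π f g x w⁻¹.toWord = -wordIntegral π f g x w.toWord := by
  have h := wordIntegral_toWord_mul π f g x w w⁻¹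
  rw [mul_inv_cancel, FreeGroup.toWord_one, hw, mul_one, wordIntegral] at h
  linarith

/-- As `w` is closed, the return along `u⁻¹` retraces the path of `u` and cancels it. -/
theorem wordIntegral_toWord_conj (x : G) (u : FreeGroup α) {w : FreeGroup α} (hw : π w = 1) :
    wordIntegral π f g x (u * w * u⁻¹).toWord = wordIntegral π f g (x * π u) w.toWord := by
  have h := wordIntegral_toWord_mul π f g x u u⁻¹
  rw [mul_inv_cancel, FreeGroup.toWord_one, wordIntegral] at h
  rw [wordIntegral_toWord_mul, wordIntegral_toWord_mul, map_mul, hw, mul_one]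
  linarith

variable {π f g}

/-- The integral along a closed word is bounded by its area. -/
theorem AreaLE.abs_wordIntegral_le {R : Set (FreeGroup α)} (hR : ∀ r ∈ R, π r = 1) {B : ℝ}
    (hB : ∀ r ∈ R, ∀ x, |wordIntegral π f g x r.toWord| ≤ B) (hB0 : 0 ≤ B) {k : ℕ}
    {w : FreeGroup α} (h : AreaLE R k w) (x : G) :
    |wordIntegral π f g x w.toWord| ≤ k * B := by
  obtain ⟨l, hl, hl', rfl⟩ := h
  suffices h : |wordIntegral π f g x l.prod.toWord| ≤ l.length * B by
    refine h.trans ?_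
    gcongr
  clear hl
  induction l generalizing x with
  | nil => simp [wordIntegral]
  | cons y l ih =>
    have hy : |wordIntegral π f g x y.toWord| ≤ B := by
      obtain ⟨u, r, hr, rfl | rfl⟩ := hl' y List.mem_cons_self
      · rw [wordIntegral_toWord_conj π f g x u (hR r hr)]
        exact hB r hr _
      · rw [wordIntegral_toWord_conj π f g x u (by rw [map_inv, hR r hr, inv_one]),
          wordIntegral_toWord_inv π f g _ (hR r hr), abs_neg]
        exact hB r hr _
    have h₁ := ih (x * π y) fun y hy => hl' y (List.mem_cons_of_mem _ hy)
    rw [List.prod_cons, wordIntegral_toWord_mul, List.length_cons]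
    refine (abs_add_le _ _).trans ?_
    push_cast
    linarith

end WordIntegral

/-! ### Chains in the Cayley graph and the linear Dehn function -/

section CayleyChains

variable {V : Type*} {Γ : SimpleGraph V} {hΓ : Γ.Connected}

/-- Move both points to vertices within distance one: this adds at most `2` to the distance and two
steps to the chain, hence the `4`. -/
theorem Realization.coarselyGeodesic : CoarselyGeodesic (Realization hΓ) := by
  intro x y
  obtain ⟨u, hu⟩ := Realization.exists_dist_vertex_le x
  obtain ⟨v, hv⟩ := Realization.exists_dist_vertex_le y
  obtain ⟨p, hp⟩ := hΓ.exists_walk_length_eq_dist u v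
  have hd : (p.length : ℝ) ≤ dist x y + 2 := by
    rw [hp, ← Realization.dist_vertex (hΓ := hΓ)]
    have := dist_triangle4 (Realization.vertex hΓ u) x y (Realization.vertex hΓ v)
    rw [dist_comm _ x] at this
    linarith
  refine ⟨p.length + 2, fun i => if i = 0 then x else if i ≤ p.length + 1 then
    Realization.vertex hΓ (p.getVert (i - 1)) else y, by push_cast; linarith, by simp, by simp, ?_⟩
  intro i hi
  rcases Nat.eq_zero_or_pos i with rfl | hi0
  · simpa using hu
  · simp only [hi0.ne', ↓reduceIte, if_pos (show i ≤ p.length + 1 by omega),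
      Nat.add_eq_zero_iff, one_ne_zero, and_false]
    split_ifs with h
    · rw [Realization.dist_vertex]
      have hadj := p.adj_getVert_succ (i := i - 1) (by omega)
      rw [show i - 1 + 1 = i + 1 - 1 by omega] at hadj
      rw [SimpleGraph.dist_eq_one_iff_adj.2 hadj, Nat.cast_one]
    · rw [show i - 1 = p.length by omega, SimpleGraph.Walk.getVert_length, dist_comm]
      exact hv

variable {α G : Type*} [Group G] {S : Set G} {π : FreeGroup α →* G}

/-- A chain in the Cayley graph is close to a path along edges. -/
theorem HasChain.exists_word (hS : S = Set.range fun a => π (FreeGroup.of a))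
    (hcl : Subgroup.closure S = ⊤) {f g : CayleySpace S hcl → ℝ} (hf : LipschitzWith 1 f)
    (hg : LipschitzWith 1 g) {ν : CayleySpace S hcl → G}
    (hν : ∀ x, dist x (Realization.vertex _ (ν x)) ≤ 1) {x y : CayleySpace S hcl} {n : ℕ} {a : ℝ}
    (h : HasChain f g x y n a) : ∃ w : List (α × Bool), w.length ≤ 3 * n ∧
      ν x * π (FreeGroup.mk w) = ν y ∧
      |a + (f y + f (Realization.vertex _ (ν y))) / 2 * (g (Realization.vertex _ (ν y)) - g y) -
        (f x + f (Realization.vertex _ (ν x))) / 2 * (g (Realization.vertex _ (ν x)) - g x) -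
        wordIntegral π (fun v => f (Realization.vertex _ v)) (fun v => g (Realization.vertex _ v))
          (ν x) w| ≤ 16 * n := by
  have hlip : ∀ {f : CayleySpace S hcl → ℝ}, LipschitzWith 1 f → ∀ p q, |f p - f q| ≤ dist p q := by
    intro f hf p q
    simpa [Real.dist_eq] using hf.dist_le_mul p q
  have hletter : ∀ {f : CayleySpace S hcl → ℝ}, LipschitzWith 1 f → ∀ (x : G) (a : α × Bool),
      |f (Realization.vertex _ (x * π (FreeGroup.mk [a]))) - f (Realization.vertex _ x)| ≤ 1 := by
    intro f hf x a
    refine (hlip hf _ _).trans ?_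
    rw [dist_comm, Realization.dist_vertex]
    exact_mod_cast dist_mul_word_le hS hcl x [a]
  induction h with
  | nil x => exact ⟨[], by simp, by simp [← FreeGroup.one_eq_mk], by simp [wordIntegral]⟩
  | @cons x y z n a hd _ ih =>
    obtain ⟨w, hw, hw', hwa⟩ := ih
    obtain ⟨w₀, hw₀, hw₀'⟩ := exists_geodesic_word hS hcl (ν x) (ν y)
    set vx := Realization.vertex (mulCayley_connected S hcl) (ν x) with hvx
    set vy := Realization.vertex (mulCayley_connected S hcl) (ν y) with hvy
    have hvxy : dist vx vy ≤ 3 := by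
      have := dist_triangle4 vx x y vy
      rw [dist_comm vx x] at this
      linarith [hν x, hν y]
    have hw₀3 : w₀.length ≤ 3 := by
      rw [hvx, hvy, Realization.dist_vertex, ← hw₀] at hvxy
      exact_mod_cast hvxy
    refine ⟨w₀ ++ w, by rw [List.length_append]; omega, ?_, ?_⟩
    · rw [← FreeGroup.mul_mk, map_mul, ← mul_assoc, hw₀', hw']
    · rw [wordIntegral_append, hw₀']
      have hfx : ∀ q, |f q - f x| ≤ dist x q := fun q => dist_comm x q ▸ hlip hf q x
      have hxvy : dist x vy ≤ 2 := by
        have := dist_triangle x y vy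
        linarith [hν y]
      -- The closed path `x`, `y`, `vy`, back along `w₀` to `vx`, and `x` is compared with the
      -- constant `f x`, whose integral against `dg` is zero. The errors are `1`, `2`, `12` and `1`,
      -- in total `16` per step.
      have h₁ := abs_edge_sub_le (r := 1) (s := 1) (a := f x) (b := f y) (c := f x)
        (d := g y - g x) (by simp) ((hfx y).trans hd)
        ((hlip hg y x).trans (by rwa [dist_comm]))
      have h₂ := abs_edge_sub_le (r := 2) (s := 1) (a := f y) (b := f vy) (c := f x)
        (d := g vy - g y) ((hfx y).trans (by linarith)) ((hfx vy).trans hxvy)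
        ((hlip hg vy y).trans (by rw [dist_comm]; exact hν y))
      have h₃ := abs_edge_sub_le (r := 1) (s := 1) (a := f x) (b := f vx) (c := f x)
        (d := g vx - g x) (by simp) ((hfx vx).trans (hν x))
        ((hlip hg vx x).trans (by rw [dist_comm]; exact hν x))
      have h₄ := abs_wordIntegral_sub_le (π := π) (f := fun v => f (Realization.vertex _ v))
        (g := fun v => g (Realization.vertex _ v)) (hletter hf) (hletter hg) w₀ (ν x) (c := f x)
        (k := 1) ((hfx vx).trans (hν x))
      rw [hw₀', ← hvx, ← hvy] at h₄
      have h₅ : (w₀.length : ℝ) ≤ 3 := by exact_mod_cast hw₀3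
      have h₆ : (1 + (w₀.length : ℝ)) * w₀.length ≤ 12 := by
        have : (0 : ℝ) ≤ w₀.length := Nat.cast_nonneg _
        nlinarith
      push_cast
      rw [abs_le] at *
      constructor <;> linarith

end CayleyChains

/-- A group with a finite presentation whose Dehn function is linear is hyperbolic. -/
theorem FinitePresentation.HasLinearDehnFunction.isHyperbolicGroup {G : Type*} [Group G]
    {P : FinitePresentation G} (h : P.HasLinearDehnFunction) : IsHyperbolicGroup G := by
  obtain ⟨K, hK⟩ := h.areaLE
  set S : Set G := Set.range fun a => P.proj (FreeGroup.of a) with hS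
  have hcl : Subgroup.closure S = ⊤ := by
    have : S = P.proj '' Set.range FreeGroup.of := by
      rw [hS, ← Set.range_comp]
      rfl
    rw [this, ← MonoidHom.map_closure, FreeGroup.closure_range_of,
      ← MonoidHom.range_eq_map, MonoidHom.range_eq_top.2 P.proj_surjective]
  obtain ⟨M, hM⟩ : ∃ M : ℕ, ∀ r ∈ P.rels, r.norm ≤ M := by
    obtain ⟨M, hM⟩ := (P.rels_finite.image FreeGroup.norm).bddAbove
    exact ⟨M, fun r hr => hM ⟨r, hr, rfl⟩⟩
  choose ν hν using Realization.exists_dist_vertex_le (hΓ := mulCayley_connected S hcl)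
  -- `16` per step for moving to an edge path, whose length is at most `3 * n`; then `K` relators
  -- per letter, each with integral at most `M * M`.
  have hchain : ChainInequality (CayleySpace S hcl) (16 + 3 * K * (M * M)) := by
    intro f g hf hg x n a ha
    obtain ⟨w, hw, hw', hwa⟩ := ha.exists_word hS hcl hf hg hν
    have hlip : ∀ {f : CayleySpace S hcl → ℝ}, LipschitzWith 1 f → ∀ (x : G)
        (a : Fin P.n × Bool), |f (Realization.vertex _ (x * P.proj (FreeGroup.mk [a]))) -
          f (Realization.vertex _ x)| ≤ 1 := by
      intro f hf x a
      have h₁ := hf.dist_le_mul (Realization.vertex _ (x * P.proj (FreeGroup.mk [a])))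
        (Realization.vertex _ x)
      rw [NNReal.coe_one, one_mul, Real.dist_eq, dist_comm, Realization.dist_vertex] at h₁
      refine h₁.trans ?_
      exact_mod_cast dist_mul_word_le hS hcl x [a]
    have hw1 : P.proj (FreeGroup.mk w) = 1 := by simpa using hw'
    have h₁ := (hK _ hw1).abs_wordIntegral_le (fun r hr => P.proj_rel hr)
      (f := fun v => f (Realization.vertex _ v)) (g := fun v => g (Realization.vertex _ v))
      (B := M * M) (fun r hr y => ?_) (by positivity) (ν x)
    · rw [wordIntegral_toWord_mk] at h₁
      have h₂ : ((FreeGroup.mk w).norm : ℝ) ≤ 3 * n := by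
        exact_mod_cast FreeGroup.norm_mk_le.trans hw
      have h₃ : ((K * (FreeGroup.mk w).norm : ℕ) : ℝ) * (M * M) ≤ K * (3 * n) * (M * M) := by
        push_cast
        gcongr
      -- The chain is closed, so the corrections at its two ends cancel.
      rw [add_sub_cancel_right] at hwa
      have h₄ := abs_sub_abs_le_abs_sub a (wordIntegral P.proj
        (fun v => f (Realization.vertex _ v)) (fun v => g (Realization.vertex _ v)) (ν x) w)
      linarith
    · have h₂ := abs_wordIntegral_sub_le (π := P.proj) (f := fun v => f (Realization.vertex _ v))
        (g := fun v => g (Realization.vertex _ v)) (hlip hf) (hlip hg) r.toWord y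
        (c := f (Realization.vertex _ y)) (k := 0) (by simp)
      rw [FreeGroup.mk_toWord, P.proj_rel hr, mul_one, sub_self, mul_zero, sub_zero, zero_add] at h₂
      have h₃ : ((r.toWord.length : ℕ) : ℝ) ≤ M := by exact_mod_cast hM r hr
      exact h₂.trans (by gcongr)
  exact ⟨S, hcl, Set.finite_range _, _, by positivity,
    hchain.thinTriangles (by positivity) Realization.coarselyGeodesic⟩

end GGT

theorem mainTheorem6 (G : Type*) [Group G] :
    -- a hyperbolic group is finitely presented
    (GGT.IsHyperbolicGroup G → Group.IsFinitelyPresented G) ∧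
    -- and all its finite presentations satisfy a linear isoperimetric inequality
    (GGT.IsHyperbolicGroup G →
      ∀ P : GGT.FinitePresentation G, P.HasLinearDehnFunction) ∧
    -- a group with a finite presentation that satisfies one is hyperbolic
    (∀ P : GGT.FinitePresentation G, P.HasLinearDehnFunction → GGT.IsHyperbolicGroup G) ∧
    -- a group is hyperbolic if and only if it has a Dehn presentation
    (GGT.IsHyperbolicGroup G ↔ ∃ P : GGT.FinitePresentation G, P.IsDehn) ∧
    -- Dehn's algorithm for a Dehn presentation solves the word problem
    (∀ P : GGT.FinitePresentation G, P.IsDehn → P.DehnAlgorithmCorrect) ∧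
    -- so the word problem is solvable in a group with a Dehn presentation
    ((∃ P : GGT.FinitePresentation G, P.IsDehn) →
      ∀ P : GGT.FinitePresentation G, P.WordProblemSolvable) := by
  refine ⟨fun h => ?_, fun h Q => ?_, fun P hP => hP.isHyperbolicGroup,
    ⟨fun h => h.exists_isDehn, fun ⟨P, hP⟩ => hP.hasLinearDehnFunction.isHyperbolicGroup⟩,
    fun P hP => hP.dehnAlgorithmCorrect, fun ⟨P, hP⟩ Q => hP.wordProblemSolvable Q⟩
  · obtain ⟨P, -⟩ := h.exists_isDehn
    exact P.isFinitelyPresented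
  · obtain ⟨P, hP⟩ := h.exists_isDehn
    exact hP.hasLinearDehnFunction.transfer Q
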